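/- **Setting.** Let $E$ be the regular hexagon of side $1$ centred at the origin with two horizontal sides, with opposite sides glued by translations. Label the horizontal sides $A$ and, going clockwise from the upper one, the next sides $B$ and $C$; opposite sides share a label. A trajectory in direction $\theta$ is a bi-infinite straight-line trajectory on the glued hexagon that never hits a vertex; its cutting sequence is the bi-infinite word in $\{A,B,C\}^{\mathbb Z}$ of the labels of the sides it hits. Let $\mathcal C(\theta)\subset\{A,B,C\}^{\mathbb Z}$ be the set of cutting sequences of trajectories in direction $\theta$ and $\overline{\mathcal C(\theta)}$ its closure in the product topology. Words are numbered up to a shift. *Farey expansion.* Let $\Sigma_i=[\frac{i\pi}6,\frac{(i+1)\pi}6]$ for $0\le i\le 5$, let $\nu_0=\mathrm{Id}$, let $\nu_2,\nu_4$ be the rotations by $-\frac{\pi}3,-\frac{2\pi}3$, and let $\nu_1,\nu_3,\nu_5$ be the reflections in the lines through the origin at angles $\frac{\pi}6,\frac{\pi}3,\frac{\pi}2$, so that $\nu_i$ maps the directions in $\Sigma_i$ onto those in $\Sigma_0$. Let $\gamma=\begin{pmatrix}-1&2\sqrt3\\0&1\end{pmatrix}$. For $\theta\in\Sigma_i$ let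 $F_i(\theta)\in[0,\pi]$ be the angle of $\gamma\nu_i(\cos\theta,\sin\theta)^T$. Write $\theta=[s_0;s_1,s_2,\dots]$ if $s_0\in\{0,\dots,5\}$, $s_k\in\{1,\dots,5\}$ for $k\ge1$, and $\theta_k\in\Sigma_{s_k}$ for all $k\ge 0$, where $\theta_0=\theta$, $\theta_{k+1}=F_{s_k}(\theta_k)$. The expansion is *terminating* if $(s_k)$ is eventually constant equal to $1$ or eventually constant equal to $5$. *Diagrams and generation.* The diagram $\mathscr D_i$ has vertices $x,y,z$ and five arrows $w_1:x\to y$, $\overline w_1:y\to x$, $w_2:y\to z$, $\overline w_2:z\to y$, $w_3:z\to z$, where $(x,y,z)$ is $(A,C,B)$, $(C,A,B)$, $(C,B,A)$, $(B,C,A)$, $(B,A,C)$, $(A,B,C)$ for $i=0,\dots,5$ respectively. A word is admissible in $\mathscr D_i$ if every two consecutive letters are joined by an arrow of $\mathscr D_i$. For $1\le i\le 5$ and $u$ admissible in $\mathscr D_i$, $\mathfrak g_i^0u$ is obtained by inserting between any two consecutive letters of $u$ the label of the arrow joining them, the labels of $(w_1,w_2,w_3,\overline w_2,\overline w_1)$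 being - $i=1$: $(\varnothing,\,CB,\,\varnothing,\,BC,\,\varnothing)$; - $i=2$: $(B,\,BC,\,CBBC,\,CB,\,B)$; - $i=3$: $(B,\,BBC,\,CBBC,\,CBB,\,B)$; - $i=4$: $(C,\,CBB,\,BB,\,BBC,\,C)$; - $i=5$: $(C,\,\varnothing,\,BB,\,\varnothing,\,C)$. For $0\le j\le5$ put $\mathfrak g_i^j=\pi_j^{-1}\cdot\mathfrak g_i^0$, where $\pi_0,\dots,\pi_5$ are the letter permutations $\mathrm{id},(AC),(ABC),(BA),(ACB),(BC)$. *Substitutions.* On bi-infinite sequences of arrows let $\sigma_1,\dots,\sigma_5$ be the substitutions with - $\sigma_1$: $w_1\mapsto\overline w_1$, $w_2\mapsto w_1w_2w_3$, $w_3\mapsto w_3$; - $\sigma_2$: $w_1\mapsto w_2w_3$, $w_2\mapsto w_3\overline w_2\,\overline w_1$, $w_3\mapsto w_1w_2w_3\overline w_2\,\overline w_1$; - $\sigma_3$: $w_1\mapsto w_3\overline w_2$, $w_2\mapsto w_2w_3\overline w_2\,\overline w_1$, $w_3\mapsto w_1w_2w_3\overline w_2\,\overline w_1$; - $\sigma_4$: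 $w_1\mapsto\overline w_2\,\overline w_1$, $w_2\mapsto w_1w_2w_3\overline w_2$, $w_3\mapsto w_2w_3\overline w_2$; - $\sigma_5$: $w_1\mapsto w_1w_2$, $w_2\mapsto\overline w_2$, $w_3\mapsto w_2w_3\overline w_2$; and $\sigma_i(\overline w_1),\sigma_i(\overline w_2)$ obtained from $\sigma_i(w_1),\sigma_i(w_2)$ by reversing the order and conjugating each arrow ($\overline{\overline w}=w$, $\overline w_3=w_3$). For a bi-infinite sequence of arrows that forms a path in the diagrams, let $\tau_i$ turn it into the word of the vertices visited in $\mathscr D_i$. **Proposition.** Let $\theta=[s_0;s_1,s_2,\dots]$, let $w\in\{A,B,C\}^{\mathbb Z}$, and consider the condition $(G)$ for every $k\ge0$ there is a word $u$ admissible in $\mathscr D_{s_k}$ with $w=\mathfrak g_{s_1}^{s_0}\mathfrak g_{s_2}^{s_1}\cdots\mathfrak g_{s_k}^{s_{k-1}}u$ up to a shift. 1. Every $w\in\mathcal C(\theta)$ satisfies $(G)$. 2. If the expansion is not terminating, then $w\in\overline{\mathcal C(\theta)}$ if and only if $w$ satisfies $(G)$. 3. If the expansion is terminating, then $w\in\mathcal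 C(\theta)$ if and only if $w$ is periodic and satisfies $(G)$. 4. $(G)$ holds if and only if for every $k\ge0$ there is a bi-infinite sequence of arrows $a$ such that $\sigma_{s_1}\sigma_{s_2}\cdots\sigma_{s_k}a$ forms a path and $w=\tau_{s_0}\,\sigma_{s_1}\sigma_{s_2}\cdots\sigma_{s_k}a$ up to a shift. -/

import Mathlib

namespace HexCut

/-! ### The hexagon and its linear trajectories -/

/-- The labels of the three pairs of opposite sides. -/
inductive Letter
  | A
  | B
  | C
  deriving DecidableEq

open Letter

instance : TopologicalSpace Letter := ⊥

instance : DiscreteTopology Letter := ⟨rfl⟩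

/-- Bi-infinite words. They carry the product of the discrete topologies. -/
abbrev Word := ℤ → Letter

/-- The plane (only its linear structure and the dot product are used). -/
abbrev Plane := Fin 2 → ℝ

/-- The unit vector at angle `θ`. -/
noncomputable def dir (θ : ℝ) : Plane := ![Real.cos θ, Real.sin θ]

/-- The outward unit normal of the `k`-th side, `k = 0, …, 5`, at angle `π/6 + kπ/3`. -/
noncomputable def normal (k : Fin 6) : Plane := dir (Real.pi / 6 + (k : ℕ) * (Real.pi / 3))

/-- The open regular hexagon of side length `1` (hence apothem `√3/2`) centred at the origin,
two of whose sides are horizontal. -/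
def hexagon : Set Plane := {z | ∀ k, normal k ⬝ᵥ z < Real.sqrt 3 / 2}

/-- The `k`-th side of the hexagon, without its end points. -/
def openSide (k : Fin 6) : Set Plane :=
  {z | normal k ⬝ᵥ z = Real.sqrt 3 / 2 ∧ ∀ j, j ≠ k → normal j ⬝ᵥ z < Real.sqrt 3 / 2}

/-- The labels of the sides: the horizontal sides (`k = 1, 4`) are `A`, and going clockwise from
the upper one the next sides are `B` (`k = 0`) and `C` (`k = 5`); opposite sides share a label. -/
def sideLabel : Fin 6 → Letter := ![B, A, C, B, A, C]

/-- The translation gluing the `k`-th side to the opposite side. -/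
noncomputable def glue (k : Fin 6) (z : Plane) : Plane := z - Real.sqrt 3 • normal k

/-- A bi-infinite linear trajectory in direction `θ` in the hexagon with opposite sides glued,
which never hits a vertex. The trajectory hits the open side `side n` at the point `pt n`, comes
out at the glued point of the opposite side, and travels in the interior of the hexagon, in
direction `θ`, during the time `time n`, up to its next hitting point `pt (n + 1)`. -/
structure Trajectory (θ : ℝ) where
  pt : ℤ → Plane
  side : ℤ → Fin 6
  time : ℤ → ℝ
  pt_mem : ∀ n, pt n ∈ openSide (side n)
  time_pos : ∀ n, 0 < time n
  step : ∀ n, pt (n + 1) = glue (side n) (pt n) + time n • dir θ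
  inside : ∀ n, ∀ t, 0 < t → t < time n → glue (side n) (pt n) + t • dir θ ∈ hexagon

/-- The cutting sequence: the labels of the sides that are hit. -/
def Trajectory.cut {θ : ℝ} (τ : Trajectory θ) : Word := fun n => sideLabel (τ.side n)

/-- The set of all cutting sequences of trajectories in direction `θ`. -/
def cuttingSequences (θ : ℝ) : Set Word := {w | ∃ τ : Trajectory θ, τ.cut = w}

/-! ### The Farey map and the Farey expansion -/

/-- The closed sector `Σ_i = [iπ/6, (i+1)π/6]` of angles. -/
noncomputable def sector (i : Fin 6) : Set ℝ :=
  Set.Icc ((i : ℕ) * (Real.pi / 6)) (((i : ℕ) + 1) * (Real.pi / 6))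

/-- The isometry `ν_i` sending the `i`-th sector to the sector `0`. -/
noncomputable def nu : Fin 6 → Matrix (Fin 2) (Fin 2) ℝ :=
  ![!![1, 0; 0, 1],
    !![1 / 2, Real.sqrt 3 / 2; Real.sqrt 3 / 2, -(1 / 2)],
    !![1 / 2, Real.sqrt 3 / 2; -(Real.sqrt 3 / 2), 1 / 2],
    !![-(1 / 2), Real.sqrt 3 / 2; Real.sqrt 3 / 2, 1 / 2],
    !![-(1 / 2), Real.sqrt 3 / 2; -(Real.sqrt 3 / 2), -(1 / 2)],
    !![-1, 0; 0, 1]]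

/-- The Veech element `γ`. -/
noncomputable def gam : Matrix (Fin 2) (Fin 2) ℝ := !![-1, 2 * Real.sqrt 3; 0, 1]

/-- The `i`-th branch of the Farey map, used on the `i`-th sector: the angle in `[0, π]` of the
image of the direction `θ` under `γ ν_i`. In the coordinate `cot θ` it is the fractional linear
map with matrix `γ ν_i`. -/
noncomputable def fareyBranch (i : Fin 6) (θ : ℝ) : ℝ :=
  Complex.arg ⟨((gam * nu i).mulVec (dir θ)) 0, ((gam * nu i).mulVec (dir θ)) 1⟩

/-- The successive images of `θ` under the branches with indices `s 0, s 1, …`. -/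
noncomputable def fareyOrbit (s : ℕ → Fin 6) (θ : ℝ) : ℕ → ℝ
  | 0 => θ
  | k + 1 => fareyBranch (s k) (fareyOrbit s θ k)

/-- `θ = [s 0; s 1, s 2, …]`: the entries after the first one are not `0`, and `s` is an itinerary
of `θ`, i.e. `θ` lies in all the cylinders `F_{s 0}⁻¹ ⋯ F_{s k}⁻¹ [0, π]`. -/
def IsFareyExpansion (s : ℕ → Fin 6) (θ : ℝ) : Prop :=
  (∀ k, 1 ≤ k → s k ≠ 0) ∧ ∀ k, fareyOrbit s θ k ∈ sector (s k)

/-- The expansion is eventually constant, equal to `1` or to `5`. -/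
def Terminating (s : ℕ → Fin 6) : Prop :=
  ∃ K, (∀ k, K ≤ k → s k = 1) ∨ (∀ k, K ≤ k → s k = 5)

/-! ### Transition diagrams and generation operators -/

/-- All the diagrams have the shape `0 ⇄ 1 ⇄ 2 ↺`; these are the three vertices of `D_i`. -/
def vertex : Fin 6 → Fin 3 → Letter :=
  ![![A, C, B], ![C, A, B], ![C, B, A], ![B, C, A], ![B, A, C], ![A, B, C]]

/-- The five arrows of the common shape; `w1'`, `w2'` are `w1`, `w2` reversed. -/
inductive Arrow
  | w1
  | w2
  | w3
  | w2'
  | w1'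
  deriving DecidableEq

open Arrow

/-- Source of an arrow. -/
def Arrow.src : Arrow → Fin 3
  | w1 => 0
  | w2 => 1
  | w3 => 2
  | w2' => 2
  | w1' => 1

/-- Target of an arrow. -/
def Arrow.tgt : Arrow → Fin 3
  | w1 => 1
  | w2 => 2
  | w3 => 2
  | w2' => 1
  | w1' => 0

/-- In the diagram `D_i` the arrow `a` goes from the letter `L` to the letter `L'`. -/
def Joins (i : Fin 6) (a : Arrow) (L L' : Letter) : Prop :=
  vertex i a.src = L ∧ vertex i a.tgt = L'

/-- `u` is admissible in the diagram `D_i`. -/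
def Admissible (i : Fin 6) (u : Word) : Prop := ∀ n, ∃ a, Joins i a (u n) (u (n + 1))

/-- The word interpolated on the arrow `a` of `D_i` by the generation operator from `D_i` to `D_0`
(there is no such operator for `i = 0`, and the first line is never used). -/
def inserted : Fin 6 → Arrow → List Letter
  | 0, _ => []
  | 1, w1 => []
  | 1, w2 => [C, B]
  | 1, w3 => []
  | 1, w2' => [B, C]
  | 1, w1' => []
  | 2, w1 => [B]
  | 2, w2 => [B, C]
  | 2, w3 => [C, B, B, C]
  | 2, w2' => [C, B]
  | 2, w1' => [B]
  | 3, w1 => [B]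
  | 3, w2 => [B, B, C]
  | 3, w3 => [C, B, B, C]
  | 3, w2' => [C, B, B]
  | 3, w1' => [B]
  | 4, w1 => [C]
  | 4, w2 => [C, B, B]
  | 4, w3 => [B, B]
  | 4, w2' => [B, B, C]
  | 4, w1' => [C]
  | 5, w1 => [C]
  | 5, w2 => []
  | 5, w3 => [B, B]
  | 5, w2' => []
  | 5, w1' => [C]

/-- The permutation `π_i` of the labels induced by `ν_i`:
`id, (A C), (A B C), (B A), (A C B), (B C)`. -/
def perm : Fin 6 → Equiv.Perm Letter :=
  ![1, Equiv.swap A C, Equiv.swap A B * Equiv.swap B C, Equiv.swap B A,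
    (Equiv.swap A B * Equiv.swap B C)⁻¹, Equiv.swap B C]

/-- `W` is obtained from the word `u`, admissible in `D_i`, by interpolating between any two
consecutive letters the word on the arrow of `D_i` joining them. The letter `u n` sits at the
position `p n` of `W`; the numbering of the letters of `W` is thus free up to a shift. -/
def IsGenZero (i : Fin 6) (u W : Word) : Prop :=
  ∃ p : ℤ → ℤ, ∀ n, W (p n) = u n ∧ ∃ a, Joins i a (u n) (u (n + 1)) ∧
    p (n + 1) = p n + 1 + (inserted i a).length ∧
    ∀ (m : ℕ) (hm : m < (inserted i a).length), W (p n + 1 + m) = (inserted i a)[m]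

/-- `W` is, up to a shift, the image of `u` under the generation operator from `D_i` to `D_j`:
apply the operator from `D_i` to `D_0`, then the permutation `π_j⁻¹`. -/
def IsGen (i j : Fin 6) (u W : Word) : Prop :=
  ∃ V : Word, IsGenZero i u V ∧ W = fun n => (perm j)⁻¹ (V n)

/-- `w` is the image of `u` under the composition of the generation operators from `D_{s 1}` to
`D_{s 0}`, …, from `D_{s k}` to `D_{s (k-1)}` (the last one is applied first). -/
def IsGenComp (s : ℕ → Fin 6) : ℕ → Word → Word → Prop
  | 0, u, w => w = u
  | k + 1, u, w => ∃ v, IsGen (s (k + 1)) (s k) u v ∧ IsGenComp s k v w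

/-- For every `k`, `w` is in the image of the words admissible in `D_{s k}` under the first `k`
generation operators. -/
def InGenIntersection (s : ℕ → Fin 6) (w : Word) : Prop :=
  ∀ k, ∃ u, Admissible (s k) u ∧ IsGenComp s k u w

/-! ### Substitutions on arrows -/

/-- The substitutions `σ_1, …, σ_5` (there is none for `i = 0`, and the first line is never
used). -/
def subst : Fin 6 → Arrow → List Arrow
  | 0, a => [a]
  | 1, w1 => [w1']
  | 1, w2 => [w1, w2, w3]
  | 1, w3 => [w3]
  | 1, w2' => [w3, w2', w1']
  | 1, w1' => [w1]
  | 2, w1 => [w2, w3]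
  | 2, w2 => [w3, w2', w1']
  | 2, w3 => [w1, w2, w3, w2', w1']
  | 2, w2' => [w1, w2, w3]
  | 2, w1' => [w3, w2']
  | 3, w1 => [w3, w2']
  | 3, w2 => [w2, w3, w2', w1']
  | 3, w3 => [w1, w2, w3, w2', w1']
  | 3, w2' => [w1, w2, w3, w2']
  | 3, w1' => [w2, w3]
  | 4, w1 => [w2', w1']
  | 4, w2 => [w1, w2, w3, w2']
  | 4, w3 => [w2, w3, w2']
  | 4, w2' => [w2, w3, w2', w1']
  | 4, w1' => [w1, w2]
  | 5, w1 => [w1, w2]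
  | 5, w2 => [w2']
  | 5, w3 => [w2, w3, w2']
  | 5, w2' => [w2]
  | 5, w1' => [w2', w1']

/-- The bi-infinite sequence of arrows `b` is, up to a shift, the image of `a` under `σ_i`: the
block `σ_i (a n)` starts at the position `p n` of `b`. -/
def IsSubst (i : Fin 6) (a b : ℤ → Arrow) : Prop :=
  ∃ p : ℤ → ℤ, ∀ n, p (n + 1) = p n + (subst i (a n)).length ∧
    ∀ (m : ℕ) (hm : m < (subst i (a n)).length), b (p n + m) = (subst i (a n))[m]

/-- `b` is the image of `a` under `σ_{s 1} ⋯ σ_{s k}`. -/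
def IsSubstComp (s : ℕ → Fin 6) : ℕ → (ℤ → Arrow) → (ℤ → Arrow) → Prop
  | 0, a, b => b = a
  | k + 1, a, b => ∃ c, IsSubst (s (k + 1)) a c ∧ IsSubstComp s k c b

/-- The arrows of `b` form a path in the diagram `D_i`, and `w` is the word read on its vertices. -/
def IsReading (i : Fin 6) (b : ℤ → Arrow) (w : Word) : Prop :=
  ∀ n, Joins i (b n) (w n) (w (n + 1))

/-- For every `k`, `w` is read in `D_{s 0}` on `σ_{s 1} ⋯ σ_{s k} a` for some bi-infinite sequence
of arrows `a`. -/
def InSubstIntersection (s : ℕ → Fin 6) (w : Word) : Prop :=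
  ∀ k, ∃ a b, IsSubstComp s k a b ∧ IsReading (s 0) b w

end HexCut

namespace HexCut

open Letter Arrow

/-! A direction is normalized by an isometry to the sector `0`, where trajectories leave only
through three sides. The signed position of a hitting point on its side, projected transversally to
the direction, is a centred coordinate `M`. It lies in a symmetric interval whose half-length
depends on the side, and it is translated by an amount that depends only on the transition, that is,
on an arrow of the diagram. Cutting sequences thus become codings of an interval exchange with two
nonnegative parameters `α`, `κ`, which are linear in the direction vector.

The Farey map is linear in these parameters, and its inverse branches are nonnegative integer
matrices (`liftParams`, `vecParams_eq_lift`). Renormalization restricts an orbit to smaller centred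
intervals: between two visits it follows a block `σ_j a`. Hence the codings for the lifted
parameters are exactly the images under `σ_j` of the codings for the original ones
(`isCoding_lift_iff`). Iterating gives part 1. Part 4 is a finite check: the vertices read along
`σ_i a` are a letter followed by the word inserted by the generation operator (`map_subst`).

If the expansion does not terminate, both parameters stay positive at every level and the iterated
blocks become arbitrarily long. A window of a word satisfying (G) then lies in two consecutive
blocks, and every such pair of blocks occurs in a coding (`IsParams.exists_approx`). Conversely,
desubstitutions pass to limits by compactness (`exists_limit_substComp`).

If it terminates, one parameter eventually vanishes and the codings at that level are the paths
avoiding certain arrows, so they have period two. Conversely, the block starts are the positions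
where the path turns back, so a period descends to desubstitutions. It drops strictly at each step
as long as a forbidden arrow occurs, so no such arrow can occur (`IsParams.isCoding_iff_periodic`).
-/

instance : Fintype Arrow := ⟨{w1, w2, w3, w2', w1'}, fun a => by cases a <;> decide⟩

/-! ### Paths and readings -/

/-- The reversed arrow. -/
def Arrow.conj : Arrow → Arrow
  | w1 => w1'
  | w2 => w2'
  | w3 => w3
  | w2' => w2
  | w1' => w1

/-- A bi-infinite sequence of consecutive arrows. -/
def IsPath (b : ℤ → Arrow) : Prop := ∀ n, (b n).tgt = (b (n + 1)).src

theorem vertex_injective (i : Fin 6) : Function.Injective (vertex i) := by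
  revert i; decide

theorem vertex_eq_perm (i : Fin 6) (v : Fin 3) : vertex i v = (perm i)⁻¹ (vertex 0 v) := by
  revert i v; decide

theorem Arrow.eq_of_src_tgt {a a' : Arrow} (h : a.src = a'.src) (h' : a.tgt = a'.tgt) :
    a = a' := by
  revert a a'; decide

theorem Joins.eq {i : Fin 6} {a a' : Arrow} {L L' : Letter} (h : Joins i a L L')
    (h' : Joins i a' L L') : a = a' :=
  Arrow.eq_of_src_tgt (vertex_injective i (h.1.trans h'.1.symm))
    (vertex_injective i (h.2.trans h'.2.symm))

theorem isReading_iff {i : Fin 6} {b : ℤ → Arrow} {w : Word} :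
    IsReading i b w ↔ IsPath b ∧ ∀ n, w n = vertex i (b n).src := by
  constructor
  · intro h
    exact ⟨fun n => vertex_injective i ((h n).2.trans (h (n + 1)).1.symm), fun n => (h n).1.symm⟩
  · rintro ⟨h, h'⟩ n
    exact ⟨(h' n).symm, by rw [h n, h' (n + 1)]⟩

theorem admissible_iff {i : Fin 6} {u : Word} : Admissible i u ↔ ∃ a, IsReading i a u :=
  ⟨fun h => ⟨fun n => (h n).choose, fun n => (h n).choose_spec⟩, fun ⟨a, h⟩ n => ⟨a n, h n⟩⟩

theorem IsReading.eq {i : Fin 6} {b b' : ℤ → Arrow} {w : Word} (h : IsReading i b w)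
    (h' : IsReading i b' w) : b = b' :=
  funext fun n => (h n).eq (h' n)

/-! ### Bi-infinite concatenations -/

/-- A relation all of whose elements have a successor and a predecessor has bi-infinite chains
through every related pair. -/
theorem exists_int_chain {S : Type*} {R : S → S → Prop} (hf : ∀ x, ∃ y, R x y)
    (hb : ∀ y, ∃ x, R x y) {x y : S} (hxy : R x y) :
    ∃ c : ℤ → S, c 0 = x ∧ c 1 = y ∧ ∀ n, R (c n) (c (n + 1)) := by
  choose f hf using hf
  choose g hg using hb
  refine ⟨fun n => match n with
    | Int.ofNat 0 => x
    | Int.ofNat (k + 1) => f^[k] y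
    | Int.negSucc k => g^[k + 1] x, rfl, rfl, ?_⟩
  rintro (⟨_ | k⟩ | ⟨_ | k⟩)
  · exact hxy
  · change R (f^[k] y) (f^[k + 1] y)
    rw [Function.iterate_succ_apply']
    exact hf _
  · exact hg _
  · change R (g^[k + 1 + 1] x) (g^[k + 1] x)
    rw [Function.iterate_succ_apply' g (k + 1)]
    exact hg _

/-- `b` is the concatenation of the words `f (a n)`, the `n`-th of which starts at `p n`. -/
def IsConcat {X Y : Type*} (f : X → List Y) (a : ℤ → X) (b : ℤ → Y) (p : ℤ → ℤ) : Prop :=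
  ∀ n, p (n + 1) = p n + (f (a n)).length ∧
    ∀ (m : ℕ) (hm : m < (f (a n)).length), b (p n + m) = (f (a n))[m]

theorem exists_mem_block {p : ℤ → ℤ} {l : ℤ → ℕ} (hl : ∀ n, 0 < l n)
    (hp : ∀ n, p (n + 1) = p n + l n) (x : ℤ) : ∃ (n : ℤ) (m : ℕ), m < l n ∧ x = p n + m := by
  induction x using Int.inductionOn' (b := p 0) with
  | zero => exact ⟨0, 0, hl 0, by simp⟩
  | succ k _ ih =>
    obtain ⟨n, m, hm, rfl⟩ := ih
    by_cases h : m + 1 < l n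
    · exact ⟨n, m + 1, h, by push_cast; ring⟩
    · exact ⟨n + 1, 0, hl _, by have := hp n; push_cast; omega⟩
  | pred k _ ih =>
    obtain ⟨n, m, hm, rfl⟩ := ih
    rcases m with _ | m
    · have h := hp (n - 1)
      have h' := hl (n - 1)
      rw [sub_add_cancel] at h
      exact ⟨n - 1, l (n - 1) - 1, by omega, by push_cast; omega⟩
    · exact ⟨n, m, by omega, by push_cast; ring⟩

theorem strictMono_of_blocks {p : ℤ → ℤ} {l : ℤ → ℕ} (hl : ∀ n, 0 < l n)
    (hp : ∀ n, p (n + 1) = p n + l n) : StrictMono p :=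
  strictMono_int_of_lt_succ fun n => by have := hp n; have := hl n; omega

theorem block_unique {p : ℤ → ℤ} {l : ℤ → ℕ} (hl : ∀ n, 0 < l n)
    (hp : ∀ n, p (n + 1) = p n + l n) {n n' : ℤ} {m m' : ℕ} (hm : m < l n) (hm' : m' < l n')
    (h : p n + m = p n' + m') : n = n' ∧ m = m' := by
  have mono := (strictMono_of_blocks hl hp).monotone
  have key : n = n' := by
    rcases lt_trichotomy n n' with hlt | heq | hlt
    · have := mono (show n + 1 ≤ n' by omega)
      have := hp n
      omega
    · exact heq
    · have := mono (show n' + 1 ≤ n by omega)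
      have := hp n'
      omega
  subst key
  exact ⟨rfl, by omega⟩

theorem exists_block_starts (l : ℤ → ℕ) : ∃ p : ℤ → ℤ, ∀ n, p (n + 1) = p n + l n := by
  -- The index travels in the first coordinate, so that the recursion becomes a relation between
  -- states.
  obtain ⟨c, h0, -, hc⟩ := exists_int_chain (S := ℤ × ℤ)
    (R := fun x y => y.1 = x.1 + 1 ∧ y.2 = x.2 + l x.1)
    (fun x => ⟨(x.1 + 1, x.2 + l x.1), rfl, rfl⟩)
    (fun y => ⟨(y.1 - 1, y.2 - l (y.1 - 1)), by simp, by simp⟩)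
    (x := (0, 0)) (y := (1, l 0)) (by simp)
  have h1 : ∀ n, (c n).1 = n := by
    intro n
    induction n using Int.induction_on with
    | zero => simp [h0]
    | succ k ih => rw [(hc k).1, ih]
    | pred k ih => have := (hc (-k - 1)).1; rw [sub_add_cancel] at this; omega
  exact ⟨fun n => (c n).2, fun n => by simpa only [h1] using (hc n).2⟩

section Concat

variable {X Y : Type*} {f : X → List Y} {a : ℤ → X} {b : ℤ → Y} {p : ℤ → ℤ}

theorem exists_isConcat_of_starts (hf : ∀ x, 0 < (f x).length)
    (hp : ∀ n, p (n + 1) = p n + (f (a n)).length) : ∃ b, IsConcat f a b p := by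
  choose N m hm hx using exists_mem_block (fun n => hf (a n)) hp
  refine ⟨fun x => (f (a (N x)))[m x]'(hm x), fun n => ⟨hp n, fun k hk => ?_⟩⟩
  obtain ⟨h1, h2⟩ := block_unique (fun n => hf (a n)) hp hk (hm _) (hx (p n + k))
  simp only [← h1, ← h2]

theorem exists_isConcat (hf : ∀ x, 0 < (f x).length) (a : ℤ → X) : ∃ b p, IsConcat f a b p := by
  obtain ⟨p, hp⟩ := exists_block_starts fun n => (f (a n)).length
  obtain ⟨b, hb⟩ := exists_isConcat_of_starts hf hp
  exact ⟨b, p, hb⟩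

theorem IsConcat.exists_mem (h : IsConcat f a b p) (hf : ∀ x, 0 < (f x).length) (x : ℤ) :
    ∃ (n : ℤ) (m : ℕ), m < (f (a n)).length ∧ x = p n + m :=
  exists_mem_block (fun n => hf (a n)) (fun n => (h n).1) x

theorem IsConcat.strictMono (h : IsConcat f a b p) (hf : ∀ x, 0 < (f x).length) : StrictMono p :=
  strictMono_of_blocks (fun n => hf (a n)) (fun n => (h n).1)

theorem IsConcat.getElem?_eq (h : IsConcat f a b p) {n : ℤ} {m : ℕ}
    (hm : m < (f (a n)).length) : (f (a n))[m]? = some (b (p n + m)) := by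
  rw [(h n).2 m hm, List.getElem?_eq_getElem hm]

theorem IsConcat.shift (h : IsConcat f a b p) (r t : ℤ) :
    IsConcat f (fun n => a (n + r)) (fun n => b (n + t)) (fun n => p (n + r) - t) := by
  intro n
  have h1 := h (n + r)
  refine ⟨?_, fun m hm => ?_⟩
  · have := h1.1
    rw [add_right_comm] at this
    dsimp only
    omega
  · rw [← h1.2 m hm]
    dsimp only
    congr 1; ring

end Concat

theorem isSubst_iff {i : Fin 6} {a b : ℤ → Arrow} :
    IsSubst i a b ↔ ∃ p, IsConcat (subst i) a b p := Iff.rfl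

theorem subst_length_pos (i : Fin 6) (a : Arrow) : 0 < (subst i a).length := by
  revert i a; decide

theorem subst_length_le (i : Fin 6) (a : Arrow) : (subst i a).length ≤ 5 := by
  revert i a; decide

/-! ### Generation operators and substitutions -/

/-- The blocks `σ_i a` with `a` starting at `v` start at the vertex `turn i v`. -/
def turn : Fin 6 → Fin 3 → Fin 3 :=
  ![![0, 1, 2], ![1, 0, 2], ![1, 2, 0], ![2, 1, 0], ![2, 0, 1], ![0, 2, 1]]

theorem turn_injective (i : Fin 6) : Function.Injective (turn i) := by
  revert i; decide

theorem subst_chain (i : Fin 6) (a : Arrow) (m : ℕ) (x y : Arrow)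
    (hx : (subst i a)[m]? = some x) (hy : (subst i a)[m + 1]? = some y) : x.tgt = y.src := by
  have hm : m < 5 := by
    have := (List.getElem?_eq_some_iff.1 hx).1
    have := subst_length_le i a
    omega
  revert i a x y
  interval_cases m <;> decide

theorem subst_head_src (i : Fin 6) (a x : Arrow) (hx : (subst i a)[0]? = some x) :
    x.src = turn i a.src := by
  revert i a x; decide

theorem subst_last_tgt (i : Fin 6) (a x : Arrow)
    (hx : (subst i a)[(subst i a).length - 1]? = some x) : x.tgt = turn i a.tgt := by
  revert i a x; decide

/-- This finite check is the whole dictionary between generation operators and substitutions.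
Everything about part 4 beyond it is bookkeeping of positions. -/
theorem map_subst (i : Fin 6) (a : Arrow) :
    (subst i a).map (fun x => vertex 0 x.src) = vertex i a.src :: inserted i a := by
  revert i a; decide

section Paths

variable {i : Fin 6} {a b : ℤ → Arrow} {p : ℤ → ℤ}

theorem IsConcat.src_start (h : IsConcat (subst i) a b p) (n : ℤ) :
    (b (p n)).src = turn i (a n).src := by
  apply subst_head_src
  simpa using h.getElem?_eq (subst_length_pos i (a n))

theorem IsConcat.tgt_end (h : IsConcat (subst i) a b p) (n : ℤ) :
    (b (p (n + 1) - 1)).tgt = turn i (a n).tgt := by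
  apply subst_last_tgt
  have := subst_length_pos i (a n)
  rw [h.getElem?_eq (by omega)]
  congr 2
  have := (h n).1
  omega

/-- Arrows inside a block compose by `subst_chain`. Across a boundary they compose because the end
points of a block are the images under `turn i` of the end points of its arrow. Injectivity of `turn
i` gives the converse below. -/
theorem IsConcat.isPath (h : IsConcat (subst i) a b p) (ha : IsPath a) : IsPath b := by
  intro x
  obtain ⟨n, m, hm, rfl⟩ := h.exists_mem (subst_length_pos i) x
  by_cases h' : m + 1 < (subst i (a n)).length
  · refine subst_chain i (a n) m _ _ (h.getElem?_eq hm) ?_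
    rw [h.getElem?_eq h']
    push_cast
    rw [add_assoc]
  · have h1 := h.tgt_end n
    have h2 := h.src_start (n + 1)
    have h3 := (h n).1
    rw [show p (n + 1) - 1 = p n + m by omega] at h1
    rw [show p (n + 1) = p n + m + 1 by omega] at h2
    rw [h1, h2, ha n]

theorem IsConcat.isPath_of_isPath (h : IsConcat (subst i) a b p) (hb : IsPath b) : IsPath a := by
  intro n
  apply turn_injective i
  rw [← h.tgt_end, ← h.src_start, hb, sub_add_cancel]

end Paths

/-- A letter together with the word inserted after it has the length of the block `σ_i (a n)`, so
the same starting positions serve on both sides, and `map_subst` matches the contents. -/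
theorem isGenZero_iff {i : Fin 6} {a : ℤ → Arrow} {u V : Word} (hu : IsReading i a u) :
    IsGenZero i u V ↔ ∃ b, IsSubst i a b ∧ ∀ n, V n = vertex 0 (b n).src := by
  have hlen : ∀ n, (subst i (a n)).length = 1 + (inserted i (a n)).length := fun n => by
    have := congrArg List.length (map_subst i (a n))
    simpa [add_comm] using this
  constructor
  · rintro ⟨p, hp⟩
    have hp1 : ∀ n, p (n + 1) = p n + (subst i (a n)).length := fun n => by
      obtain ⟨-, a', ha', h, -⟩ := hp n
      rw [(hu n).eq ha', h, ← (hu n).eq ha', hlen]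
      push_cast; ring
    obtain ⟨b, hb⟩ := exists_isConcat_of_starts (subst_length_pos i) hp1
    refine ⟨b, ⟨p, hb⟩, fun x => ?_⟩
    obtain ⟨n, m, hm, rfl⟩ := hb.exists_mem (subst_length_pos i) x
    have h1 : (vertex i (a n).src :: inserted i (a n))[m]? = some (vertex 0 (b (p n + m)).src) := by
      rw [← map_subst, List.getElem?_map, hb.getElem?_eq hm]
      rfl
    obtain ⟨h2, a', ha', -, h3⟩ := hp n
    rw [← (hu n).eq ha'] at h3
    rcases m with _ | m
    · simp only [Nat.cast_zero, add_zero, List.getElem?_cons_zero, Option.some.injEq] at h1 ⊢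
      rw [← h1, h2, (hu n).1]
    · have hm' : m < (inserted i (a n)).length := by have := hlen n; omega
      rw [List.getElem?_cons_succ, List.getElem?_eq_getElem hm', Option.some.injEq] at h1
      rw [← h1, ← h3 m hm']
      congr 1; push_cast; ring
  · rintro ⟨b, ⟨p, hb⟩, hV⟩
    have key : ∀ n m, m < (subst i (a n)).length →
        (vertex i (a n).src :: inserted i (a n))[m]? = some (V (p n + m)) := fun n m hm => by
      rw [← map_subst, List.getElem?_map, IsConcat.getElem?_eq hb hm, hV]
      rfl
    refine ⟨p, fun n => ⟨?_, a n, hu n, ?_, fun m hm => ?_⟩⟩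
    · have := key n 0 (subst_length_pos i _)
      simp only [List.getElem?_cons_zero, Option.some.injEq, Nat.cast_zero, add_zero] at this
      rw [← this, (hu n).1]
    · rw [(hb n).1, hlen]; push_cast; ring
    · have := key n (m + 1) (by have := hlen n; omega)
      rw [List.getElem?_cons_succ, List.getElem?_eq_getElem hm, Option.some.injEq] at this
      rw [this]
      congr 1; push_cast; ring

theorem isGen_iff {i j : Fin 6} {a : ℤ → Arrow} {u W : Word} (hu : IsReading i a u) :
    IsGen i j u W ↔ ∃ b, IsSubst i a b ∧ IsReading j b W := by
  constructor
  · rintro ⟨V, hV, rfl⟩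
    obtain ⟨b, ⟨p, hb⟩, h⟩ := (isGenZero_iff hu).1 hV
    refine ⟨b, ⟨p, hb⟩, isReading_iff.2 ⟨IsConcat.isPath hb (isReading_iff.1 hu).1, fun n => ?_⟩⟩
    rw [vertex_eq_perm, h]
  · rintro ⟨b, hb, h⟩
    refine ⟨fun n => vertex 0 (b n).src, (isGenZero_iff hu).2 ⟨b, hb, fun _ => rfl⟩, ?_⟩
    funext n
    rw [(isReading_iff.1 h).2, vertex_eq_perm]

theorem IsSubstComp.isPath_of_isPath {s : ℕ → Fin 6} {k : ℕ} {a b : ℤ → Arrow}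
    (h : IsSubstComp s k a b) (hb : IsPath b) : IsPath a := by
  induction k generalizing a with
  | zero => exact (show b = a from h) ▸ hb
  | succ k ih =>
    obtain ⟨c, ⟨p, hc⟩, h⟩ := h
    exact IsConcat.isPath_of_isPath hc (ih h)

/-- The intermediate words of a composition are recovered from the arrows: the path property
descends through desubstitution, so each intermediate sequence of arrows can be read in its own
diagram. -/
theorem isGenComp_iff {s : ℕ → Fin 6} {k : ℕ} {a : ℤ → Arrow} {u w : Word}
    (hu : IsReading (s k) a u) :
    IsGenComp s k u w ↔ ∃ b, IsSubstComp s k a b ∧ IsReading (s 0) b w := by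
  induction k generalizing a u with
  | zero =>
    constructor
    · rintro rfl
      exact ⟨a, rfl, hu⟩
    · rintro ⟨b, rfl, h⟩
      funext n
      rw [(isReading_iff.1 h).2, (isReading_iff.1 hu).2]
  | succ k ih =>
    constructor
    · rintro ⟨v, hv, h⟩
      obtain ⟨c, hc, hcv⟩ := (isGen_iff hu).1 hv
      obtain ⟨b, hb, hbw⟩ := (ih hcv).1 h
      exact ⟨b, ⟨c, hc, hb⟩, hbw⟩
    · rintro ⟨b, ⟨c, hc, hb⟩, hbw⟩
      have hcv : IsReading (s k) c fun n => vertex (s k) (c n).src :=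
        isReading_iff.2 ⟨hb.isPath_of_isPath (isReading_iff.1 hbw).1, fun _ => rfl⟩
      exact ⟨_, (isGen_iff hu).2 ⟨c, hc, hcv⟩, (ih hcv).2 ⟨b, hb, hbw⟩⟩

theorem inGenIntersection_iff {s : ℕ → Fin 6} {w : Word} :
    InGenIntersection s w ↔ InSubstIntersection s w := by
  refine forall_congr' fun k => ?_
  constructor
  · rintro ⟨u, hu, h⟩
    obtain ⟨a, ha⟩ := admissible_iff.1 hu
    obtain ⟨b, hb⟩ := (isGenComp_iff ha).1 h
    exact ⟨a, b, hb⟩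
  · rintro ⟨a, b, hab, hb⟩
    have ha : IsReading (s k) a fun n => vertex (s k) (a n).src :=
      isReading_iff.2 ⟨hab.isPath_of_isPath (isReading_iff.1 hb).1, fun _ => rfl⟩
    exact ⟨_, admissible_iff.2 ⟨a, ha⟩, (isGenComp_iff ha).2 ⟨b, hab, hb⟩⟩

/-! ### Codings of orbits of the interval exchange -/

/-- The widths of the intervals of hitting points on the sides labelled by the three vertices. -/
def width (α κ : ℝ) : Fin 3 → ℝ := ![α, α + κ, 2 * α + κ]

/-- The displacement of the centred transverse coordinate along an arrow. -/
def disp (α κ : ℝ) : Arrow → ℝ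
  | w1 => -κ
  | w2 => 3 * α
  | w3 => -2 * κ
  | w2' => 3 * α
  | w1' => -κ

/-- `b` is the sequence of arrows of an orbit, and `M` the sequence of the centred transverse
coordinates of the hitting points. -/
def IsOrbit (α κ : ℝ) (b : ℤ → Arrow) (M : ℤ → ℝ) : Prop :=
  IsPath b ∧ ∀ n, |M n| < width α κ (b n).src ∧ M (n + 1) = M n + disp α κ (b n)

/-- `b` codes an orbit for the parameters `α`, `κ`. -/
def IsCoding (α κ : ℝ) (b : ℤ → Arrow) : Prop := ∃ M, IsOrbit α κ b M

/-- The parameters of a direction from those of its image under the Farey map. -/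
def liftParams : Fin 6 → ℝ × ℝ → ℝ × ℝ
  | 0, x => x
  | 1, x => (x.1 + x.2, x.2)
  | 2, x => (2 * x.1 + x.2, 3 * x.1 + x.2)
  | 3, x => (2 * x.1 + x.2, 3 * x.1 + 2 * x.2)
  | 4, x => (x.1 + x.2, 3 * x.1 + 2 * x.2)
  | 5, x => (x.1, 3 * x.1 + x.2)

/-- Whether the renormalization preserves the orientation of the transverse coordinate. -/
def orient : Fin 6 → ℝ := ![1, 1, -1, 1, -1, 1]

theorem orient_mul_self (j : Fin 6) : orient j * orient j = 1 := by
  fin_cases j <;> simp [orient]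

theorem abs_orient_mul (j : Fin 6) (t : ℝ) : |orient j * t| = |t| := by
  fin_cases j <;> simp [orient]

/-- This identity makes `σ_j` a renormalization: a whole block of the lifted exchange acts as one
arrow of the original exchange, up to orientation. -/
theorem sum_disp_subst (j : Fin 6) (a : Arrow) (x : ℝ × ℝ) :
    ((subst j a).map (disp (liftParams j x).1 (liftParams j x).2)).sum =
      orient j * disp x.1 x.2 a := by
  fin_cases j <;> cases a <;> simp [subst, disp, liftParams, orient] <;> ring

/-- The partial displacements along a block are linear in the parameters. Each bound is therefore a
linear consequence of the bounds at the two ends, and there are finitely many of them. -/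
theorem abs_partial_lt {j : Fin 6} {a y : Arrow} {x : ℝ × ℝ} (h1 : 0 ≤ x.1) (h2 : 0 ≤ x.2) {t : ℝ}
    (ht : |t| < width x.1 x.2 a.src) (ht' : |t + disp x.1 x.2 a| < width x.1 x.2 a.tgt) {m : ℕ}
    (hm : (subst j a)[m]? = some y) :
    |orient j * t +
      (((subst j a).take m).map (disp (liftParams j x).1 (liftParams j x).2)).sum| <
        width (liftParams j x).1 (liftParams j x).2 y.src := by
  have hm5 : m < 5 := by
    have := (List.getElem?_eq_some_iff.1 hm).1
    have := subst_length_le j a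
    omega
  rw [abs_lt] at *
  obtain ⟨ht1, ht2⟩ := ht
  obtain ⟨ht3, ht4⟩ := ht'
  interval_cases m <;> fin_cases j <;> cases a <;>
    simp [subst] at hm <;> subst hm <;>
    simp [subst, disp, liftParams, orient, width, Arrow.src, Arrow.tgt] at ht1 ht2 ht3 ht4 ⊢ <;>
    constructor <;> linarith

theorem IsOrbit.add_nat {α κ : ℝ} {b : ℤ → Arrow} {M : ℤ → ℝ}
    (h : ∀ n, M (n + 1) = M n + disp α κ (b n)) {l : List Arrow} {n : ℤ}
    (hl : ∀ (m : ℕ) (hm : m < l.length), b (n + m) = l[m]) {m : ℕ} (hm : m ≤ l.length) :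
    M (n + m) = M n + ((l.take m).map (disp α κ)).sum := by
  induction m with
  | zero => simp
  | succ m ih =>
    have := h (n + m)
    rw [ih (by omega), hl m (by omega)] at this
    rw [List.take_add_one, List.getElem?_eq_getElem (by omega)]
    simp only [Option.toList_some, List.map_append, List.map_cons, List.map_nil, List.sum_append,
      List.sum_cons, List.sum_nil, add_zero]
    push_cast
    rw [← add_assoc n, this, add_assoc]

theorem exists_int_sum (d : ℤ → ℝ) (n₀ : ℤ) (t : ℝ) :
    ∃ M : ℤ → ℝ, M n₀ = t ∧ ∀ n, M (n + 1) = M n + d n := by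
  obtain ⟨c, h0, -, hc⟩ := exists_int_chain (S := ℤ × ℝ)
    (R := fun x y => y.1 = x.1 + 1 ∧ y.2 = x.2 + d x.1)
    (fun x => ⟨(x.1 + 1, x.2 + d x.1), rfl, rfl⟩)
    (fun y => ⟨(y.1 - 1, y.2 - d (y.1 - 1)), by simp, by simp⟩)
    (x := (n₀, t)) (y := (n₀ + 1, t + d n₀)) (by simp)
  have h1 : ∀ n, (c n).1 = n₀ + n := by
    intro n
    induction n using Int.induction_on with
    | zero => simp [h0]
    | succ k ih => rw [(hc k).1, ih]; ring
    | pred k ih => have := (hc (-k - 1)).1; rw [sub_add_cancel] at this; omega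
  refine ⟨fun n => (c (n - n₀)).2, by simp [h0], fun n => ?_⟩
  have := (hc (n - n₀)).2
  rw [h1, show n - n₀ + 1 = n + 1 - n₀ by ring, show n₀ + (n - n₀) = n by ring] at this
  exact this

/-- The lifted orbit takes the value `orient j * M' n` at the start of block `n`, consistently by
`sum_disp_subst`. Inside blocks it stays admissible by `abs_partial_lt`. -/
theorem IsCoding.lift {j : Fin 6} {x : ℝ × ℝ} (h1 : 0 ≤ x.1) (h2 : 0 ≤ x.2) {a b : ℤ → Arrow}
    (ha : IsCoding x.1 x.2 a) (hab : IsSubst j a b) :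
    IsCoding (liftParams j x).1 (liftParams j x).2 b := by
  obtain ⟨M', hpath, hM'⟩ := ha
  obtain ⟨p, hp⟩ := hab
  change IsConcat (subst j) a b p at hp
  obtain ⟨M, hM0, hM⟩ := exists_int_sum (fun n => disp (liftParams j x).1 (liftParams j x).2 (b n))
    (p 0) (orient j * M' 0)
  have hstep : ∀ n, M (p (n + 1)) = M (p n) + orient j * disp x.1 x.2 (a n) := fun n => by
    rw [(hp n).1, IsOrbit.add_nat hM (hp n).2 le_rfl, List.take_length, sum_disp_subst]
  have hMp : ∀ n, M (p n) = orient j * M' n := by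
    intro n
    induction n using Int.induction_on with
    | zero => exact hM0
    | succ k ih => rw [hstep, ih, (hM' k).2]; ring
    | pred k ih =>
      have h3 := hstep (-k - 1)
      have h4 := (hM' (-k - 1)).2
      rw [sub_add_cancel] at h3 h4
      rw [h4] at ih
      linarith
  refine ⟨M, hp.isPath hpath, fun y => ⟨?_, hM y⟩⟩
  obtain ⟨n, m, hm, rfl⟩ := hp.exists_mem (subst_length_pos j) y
  rw [IsOrbit.add_nat hM (hp n).2 hm.le, hMp]
  refine abs_partial_lt h1 h2 (hM' n).1 ?_ (hp.getElem?_eq hm)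
  rw [← (hM' n).2, hpath n]
  exact (hM' (n + 1)).1

/-! ### Turning positions -/

/-- The position of an arrow on the loop `w1 w2 w3 w2' w1'`. -/
def Arrow.rank : Arrow → ℕ
  | w1 => 0
  | w2 => 1
  | w3 => 2
  | w2' => 3
  | w1' => 4

theorem Arrow.rank_succ {a a' : Arrow} (h : a.tgt = a'.src) (h' : a' ≠ a.conj) :
    a'.rank = a.rank + 1 := by
  revert a a'; decide

/-- Without turning back, a path runs along the loop `w1 w2 w3 w2' w1'` and its rank grows by one at
each step, which is impossible five times in a row. -/
theorem IsPath.exists_turning {b : ℤ → Arrow} (h : IsPath b) : ∃ n, b (n + 1) = (b n).conj := by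
  by_contra! hne
  have key : ∀ n : ℕ, (b n).rank = (b 0).rank + n := by
    intro n
    induction n with
    | zero => simp
    | succ n ih =>
      have := Arrow.rank_succ (h n) (hne n)
      push_cast
      omega
  have h5 := key 5
  have : ∀ a : Arrow, a.rank < 5 := by decide
  have := this (b (5 : ℕ))
  omega

theorem disp_conj (α κ : ℝ) (a : Arrow) : disp α κ a.conj = disp α κ a := by
  cases a <;> rfl

theorem conj_src (a : Arrow) : a.conj.src = a.tgt := by cases a <;> rfl

theorem conj_tgt (a : Arrow) : a.conj.tgt = a.src := by cases a <;> rfl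

theorem conj_conj (a : Arrow) : a.conj.conj = a := by cases a <;> rfl

theorem subst_conj_length (j : Fin 6) (a : Arrow) :
    (subst j a.conj).length = (subst j a).length := by
  revert j a; decide

theorem subst_conj (j : Fin 6) (a : Arrow) :
    subst j a.conj = ((subst j a).map Arrow.conj).reverse := by
  revert j a; decide

/-- Reversal of orbits. -/
theorem IsOrbit.reverse {α κ : ℝ} {b : ℤ → Arrow} {M : ℤ → ℝ} (h : IsOrbit α κ b M) :
    IsOrbit α κ (fun n => (b (-n - 1)).conj) (fun n => -M (-n)) := by
  obtain ⟨hb, hM⟩ := h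
  refine ⟨fun n => ?_, fun n => ⟨?_, ?_⟩⟩
  · rw [conj_tgt, conj_src, hb]
    congr 2; ring
  · rw [abs_neg, conj_src, hb, sub_add_cancel]
    exact (hM _).1
  · have := (hM (-n - 1)).2
    rw [sub_add_cancel] at this
    rw [disp_conj]
    dsimp only
    rw [neg_add', this]
    ring

theorem IsOrbit.abs_add_disp_lt {α κ : ℝ} {b : ℤ → Arrow} {M : ℤ → ℝ} (h : IsOrbit α κ b M)
    (n : ℤ) : |M n + disp α κ (b n)| < width α κ (b n).tgt := by
  rw [← (h.2 n).2, h.1 n]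
  exact (h.2 _).1

/-- The hitting points at turning positions lie in the intervals of the renormalized exchange. -/
theorem abs_lt_of_turning {j : Fin 6} (hj : j ≠ 0) {x : ℝ × ℝ} (h1 : 0 ≤ x.1) (h2 : 0 ≤ x.2)
    {a : Arrow} {t : ℝ} (h0 : |t| < width (liftParams j x).1 (liftParams j x).2 a.src)
    (h : |t + disp (liftParams j x).1 (liftParams j x).2 a| <
      width (liftParams j x).1 (liftParams j x).2 a.tgt)
    (h' : |-t + disp (liftParams j x).1 (liftParams j x).2 a| <
      width (liftParams j x).1 (liftParams j x).2 a.tgt) :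
    ∃ v, a.src = turn j v ∧ |t| < width x.1 x.2 v := by
  rw [abs_lt] at h0 h h'
  obtain ⟨h01, h02⟩ := h0
  obtain ⟨h11, h12⟩ := h
  obtain ⟨h21, h22⟩ := h'
  fin_cases j
  · exact absurd rfl hj
  all_goals
    cases a <;>
    simp [liftParams, disp, width, Arrow.src, Arrow.tgt] at h01 h02 h11 h12 h21 h22 <;>
    simp only [Fin.exists_fin_succ] <;>
    simp [turn, Arrow.src, width, abs_lt] <;>
    first | (exfalso; linarith) | (constructor <;> linarith)

/-- An orbit follows an arrow as soon as it may. -/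
theorem IsOrbit.eq_of_abs_lt {α κ : ℝ} {b : ℤ → Arrow} {M : ℤ → ℝ}
    (h : IsOrbit α κ b M) {n : ℤ} {a : Arrow} (hsrc : a.src = (b n).src)
    (ha : |M n + disp α κ a| < width α κ a.tgt) : b n = a := by
  have h1 := h.abs_add_disp_lt n
  have h0 := (h.2 n).1
  generalize b n = c at *
  rw [abs_lt] at *
  obtain ⟨h01, h02⟩ := h0
  obtain ⟨h11, h12⟩ := h1
  obtain ⟨h21, h22⟩ := ha
  cases a <;> cases c <;> try rfl
  all_goals
    simp [Arrow.src] at hsrc <;>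
    simp [disp, width, Arrow.src, Arrow.tgt] at h01 h02 h11 h12 h21 h22 <;> exfalso <;> linarith

/-! ### Desubstitution of codings -/

theorem IsOrbit.advance {α κ : ℝ} {b : ℤ → Arrow} {M : ℤ → ℝ} (h : IsOrbit α κ b M) (a : Arrow)
    {n : ℤ} {t : ℝ} (hn : (b n).src = a.src ∧ M n = t)
    (ha : |t + disp α κ a| < width α κ a.tgt) :
    (b (n + 1)).src = a.tgt ∧ M (n + 1) = t + disp α κ a := by
  obtain ⟨hn, rfl⟩ := hn
  have hb := h.eq_of_abs_lt hn.symm ha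
  refine ⟨?_, ?_⟩
  · rw [← h.1, hb]
  · rw [(h.2 n).2, hb]

/-- Orbits avoid the common end points of the intervals of the exchange. -/
theorem IsOrbit.ne_singular {α κ : ℝ} {b : ℤ → Arrow} {M : ℤ → ℝ} (h : IsOrbit α κ b M) {n : ℤ} :
    ¬ ((b n).src = 1 ∧ M n = κ - α) ∧ ¬ ((b n).src = 2 ∧ M n = κ - 2 * α) := by
  have h1 := h.abs_add_disp_lt n
  have h0 := (h.2 n).1
  generalize b n = c at *
  rw [abs_lt] at *
  obtain ⟨h01, h02⟩ := h0
  obtain ⟨h11, h12⟩ := h1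
  cases c <;> simp [disp, width, Arrow.src, Arrow.tgt] at h01 h02 h11 h12 ⊢ <;>
    intro hM <;> linarith

/-- The points of an orbit are not at the end points of the intervals of the renormalized
exchange. -/
theorem IsOrbit.ne_lift_singular {j : Fin 6} (hj : j ≠ 0) {x : ℝ × ℝ} (h1 : 0 < x.1)
    (h2 : 0 < x.2) {b : ℤ → Arrow} {M : ℤ → ℝ}
    (h : IsOrbit (liftParams j x).1 (liftParams j x).2 b M) {n : ℤ} :
    ¬ ((b n).src = turn j 1 ∧ M n = orient j * (x.2 - x.1)) ∧
      ¬ ((b n).src = turn j 2 ∧ M n = orient j * (x.2 - 2 * x.1)) := by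
  fin_cases j
  · exact absurd rfl hj
  all_goals
    simp only [liftParams, Fin.reduceFinMk, turn, orient] at h ⊢
    simp only [Matrix.cons_val, one_mul, neg_mul] at h ⊢
    constructor <;> intro h0
  -- In each case the listed arrows carry the end point of the renormalized interval to the
  -- forbidden value `κ - α` at vertex `1` or `κ - 2α` at vertex `2`.
  · replace h0 := h.advance w1 h0 (by
      simp [abs_lt, disp, width, Arrow.tgt]; constructor <;> linarith)
    exact h.ne_singular.1 ⟨h0.1, h0.2.trans (by simp only [disp]; ring)⟩
  · replace h0 := h.advance w3 h0 (by
      simp [abs_lt, disp, width, Arrow.tgt]; constructor <;> linarith)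
    exact h.ne_singular.2 ⟨h0.1, h0.2.trans (by simp only [disp]; ring)⟩
  · replace h0 := h.advance w3 h0 (by
      simp [abs_lt, disp, width, Arrow.tgt]; constructor <;> linarith)
    replace h0 := h.advance w2' h0 (by
      simp [abs_lt, disp, width, Arrow.tgt]; constructor <;> linarith)
    exact h.ne_singular.1 ⟨h0.1, h0.2.trans (by simp only [disp]; ring)⟩
  · replace h0 := h.advance w1 h0 (by
      simp [abs_lt, disp, width, Arrow.tgt]; constructor <;> linarith)
    replace h0 := h.advance w2 h0 (by
      simp [abs_lt, disp, width, Arrow.tgt]; constructor <;> linarith)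
    replace h0 := h.advance w3 h0 (by
      simp [abs_lt, disp, width, Arrow.tgt]; constructor <;> linarith)
    exact h.ne_singular.2 ⟨h0.1, h0.2.trans (by simp only [disp]; ring)⟩
  · replace h0 := h.advance w2 h0 (by
      simp [abs_lt, disp, width, Arrow.tgt]; constructor <;> linarith)
    replace h0 := h.advance w3 h0 (by
      simp [abs_lt, disp, width, Arrow.tgt]; constructor <;> linarith)
    exact h.ne_singular.2 ⟨h0.1, h0.2.trans (by simp only [disp]; ring)⟩
  · replace h0 := h.advance w1 h0 (by
      simp [abs_lt, disp, width, Arrow.tgt]; constructor <;> linarith)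
    replace h0 := h.advance w2 h0 (by
      simp [abs_lt, disp, width, Arrow.tgt]; constructor <;> linarith)
    replace h0 := h.advance w3 h0 (by
      simp [abs_lt, disp, width, Arrow.tgt]; constructor <;> linarith)
    replace h0 := h.advance w2' h0 (by
      simp [abs_lt, disp, width, Arrow.tgt]; constructor <;> linarith)
    exact h.ne_singular.1 ⟨h0.1, h0.2.trans (by simp only [disp]; ring)⟩
  · replace h0 := h.advance w1 h0 (by
      simp [abs_lt, disp, width, Arrow.tgt]; constructor <;> linarith)
    replace h0 := h.advance w2 h0 (by
      simp [abs_lt, disp, width, Arrow.tgt]; constructor <;> linarith)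
    exact h.ne_singular.2 ⟨h0.1, h0.2.trans (by simp only [disp]; ring)⟩
  · replace h0 := h.advance w2 h0 (by
      simp [abs_lt, disp, width, Arrow.tgt]; constructor <;> linarith)
    replace h0 := h.advance w3 h0 (by
      simp [abs_lt, disp, width, Arrow.tgt]; constructor <;> linarith)
    replace h0 := h.advance w2' h0 (by
      simp [abs_lt, disp, width, Arrow.tgt]; constructor <;> linarith)
    exact h.ne_singular.1 ⟨h0.1, h0.2.trans (by simp only [disp]; ring)⟩
  · replace h0 := h.advance w2' h0 (by
      simp [abs_lt, disp, width, Arrow.tgt]; constructor <;> linarith)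
    exact h.ne_singular.1 ⟨h0.1, h0.2.trans (by simp only [disp]; ring)⟩
  · replace h0 := h.advance w2 h0 (by
      simp [abs_lt, disp, width, Arrow.tgt]; constructor <;> linarith)
    exact h.ne_singular.2 ⟨h0.1, h0.2.trans (by simp only [disp]; ring)⟩

/-- At vertices `1` and `2` two arrows compete on either side of a threshold, and the orbit avoids
the threshold by `ne_lift_singular`. Only nonnegative parameters are needed: equality with the
threshold inside the open interval already forces both to be positive. -/
theorem IsOrbit.exists_arrow {j : Fin 6} (hj : j ≠ 0) {x : ℝ × ℝ} (h1 : 0 ≤ x.1)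
    (h2 : 0 ≤ x.2) {b : ℤ → Arrow} {M : ℤ → ℝ}
    (h : IsOrbit (liftParams j x).1 (liftParams j x).2 b M) {n : ℤ} {v : Fin 3}
    (hsrc : (b n).src = turn j v) (hM : |M n| < width x.1 x.2 v) :
    ∃ a : Arrow, a.src = v ∧ |orient j * M n + disp x.1 x.2 a| < width x.1 x.2 a.tgt := by
  have hs := h.ne_lift_singular hj (n := n)
  have ho : M n = orient j * (orient j * M n) := by rw [← mul_assoc, orient_mul_self, one_mul]
  rw [ho] at hs
  rw [← abs_orient_mul j] at hM
  generalize orient j * M n = t at *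
  rw [abs_lt] at hM
  obtain ⟨hM1, hM2⟩ := hM
  fin_cases v
  · refine ⟨w1, rfl, ?_⟩
    simp [abs_lt, disp, width, Arrow.tgt] at hM1 hM2 ⊢
    constructor <;> linarith
  · simp [width] at hM1 hM2
    rcases lt_trichotomy t (x.2 - x.1) with ht | ht | ht
    · refine ⟨w2, rfl, ?_⟩
      simp [abs_lt, disp, width, Arrow.tgt]
      constructor <;> linarith
    · exact absurd ⟨hsrc, by rw [ht]⟩ (hs (by linarith) (by linarith)).1
    · refine ⟨w1', rfl, ?_⟩
      simp [abs_lt, disp, width, Arrow.tgt]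
      constructor <;> linarith
  · simp [width] at hM1 hM2
    rcases lt_trichotomy t (x.2 - 2 * x.1) with ht | ht | ht
    · refine ⟨w2', rfl, ?_⟩
      simp [abs_lt, disp, width, Arrow.tgt]
      constructor <;> linarith
    · exact absurd ⟨hsrc, by rw [ht]⟩ (hs (by linarith) (by linarith)).2
    · refine ⟨w3, rfl, ?_⟩
      simp [abs_lt, disp, width, Arrow.tgt]
      constructor <;> linarith

theorem width_le_lift {j : Fin 6} {x : ℝ × ℝ} (h1 : 0 ≤ x.1) (h2 : 0 ≤ x.2) (v : Fin 3) :
    width x.1 x.2 v ≤ width (liftParams j x).1 (liftParams j x).2 (turn j v) := by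
  fin_cases j <;> fin_cases v <;> simp [width, liftParams, turn] <;> linarith

/-- An orbit follows the block `σ_j a` as soon as it may. -/
theorem IsOrbit.follow {j : Fin 6} {x : ℝ × ℝ} (h1 : 0 ≤ x.1)
    (h2 : 0 ≤ x.2) {b : ℤ → Arrow} {M : ℤ → ℝ}
    (h : IsOrbit (liftParams j x).1 (liftParams j x).2 b M) {n : ℤ} {a : Arrow}
    (hsrc : (b n).src = turn j a.src) (hM : |M n| < width x.1 x.2 a.src)
    (ha : |orient j * M n + disp x.1 x.2 a| < width x.1 x.2 a.tgt) :
    (∀ (m : ℕ) (hm : m < (subst j a).length), b (n + m) = (subst j a)[m]) ∧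
      (b (n + (subst j a).length)).src = turn j a.tgt ∧
      orient j * M (n + (subst j a).length) = orient j * M n + disp x.1 x.2 a := by
  have ho : orient j * (orient j * M n) = M n := by rw [← mul_assoc, orient_mul_self, one_mul]
  rw [← abs_orient_mul j] at hM
  have hsum := sum_disp_subst j a x
  set d := disp (liftParams j x).1 (liftParams j x).2 with hd
  have hbound : ∀ (m : ℕ) (y : Arrow), (subst j a)[m]? = some y →
      |M n + (((subst j a).take (m + 1)).map d).sum| <
        width (liftParams j x).1 (liftParams j x).2 y.tgt := by
    intro m y hy
    obtain ⟨hm, -⟩ := List.getElem?_eq_some_iff.1 hy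
    by_cases hm' : m + 1 < (subst j a).length
    · obtain ⟨z, hz⟩ : ∃ z, (subst j a)[m + 1]? = some z := ⟨_, List.getElem?_eq_getElem hm'⟩
      rw [subst_chain j a m y z hy hz, ← ho]
      exact abs_partial_lt h1 h2 hM ha hz
    · have hlen : m + 1 = (subst j a).length := by omega
      rw [hlen, List.take_length, hsum, ← ho, ← mul_add, abs_orient_mul,
        subst_last_tgt j a y (by rw [← hlen]; exact hy)]
      exact ha.trans_le (width_le_lift h1 h2 _)
  -- As long as a prefix of the block has been followed, `M` is known by partial sums. The next
  -- arrow of the block is then allowed, and by determinism it is the one taken.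
  have key : ∀ m, m ≤ (subst j a).length →
      ∀ i, i < m → (subst j a)[i]? = some (b (n + i)) := by
    intro m
    induction m with
    | zero => intro _ i hi; omega
    | succ m ih =>
      intro hm i hi
      obtain hi | rfl : i < m ∨ i = m := by omega
      · exact ih (by omega) i hi
      replace ih := ih (by omega)
      obtain ⟨y, hy⟩ : ∃ y, (subst j a)[i]? = some y := ⟨_, List.getElem?_eq_getElem hm⟩
      have hMi : M (n + i) = M n + (((subst j a).take i).map d).sum := by
        have := IsOrbit.add_nat (fun n => (h.2 n).2) (l := (subst j a).take i) (n := n) (m := i)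
          (fun k hk => ?_) (by simp; omega)
        · rwa [List.take_take, min_self] at this
        · have hk' : k < i := by simp at hk; omega
          have := ih k hk'
          rw [List.getElem?_eq_getElem (by omega), Option.some.injEq] at this
          rw [List.getElem_take, this]
      rw [hy, h.eq_of_abs_lt (a := y)]
      · rcases i with _ | i
        · rw [subst_head_src j a y hy, ← hsrc]
          simp
        · rw [← subst_chain j a i _ y (ih i (by omega)) hy, h.1]
          push_cast
          rw [add_assoc]
      · have := hbound i y hy
        rw [List.take_add_one, hy] at this
        simp only [Option.toList_some, List.map_append, List.map_cons, List.map_nil,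
          List.sum_append, List.sum_cons, List.sum_nil, add_zero] at this
        rwa [hMi, add_assoc]
  have hb : ∀ (m : ℕ) (hm : m < (subst j a).length), b (n + m) = (subst j a)[m] := by
    intro m hm
    have := key _ le_rfl m hm
    rw [List.getElem?_eq_getElem hm, Option.some.injEq] at this
    exact this.symm
  refine ⟨hb, ?_, ?_⟩
  · have hpos := subst_length_pos j a
    have := subst_last_tgt j a _ (key _ le_rfl ((subst j a).length - 1) (by omega))
    rw [← this, h.1]
    congr 2
    omega
  · rw [IsOrbit.add_nat (fun n => (h.2 n).2) hb le_rfl, List.take_length, hsum, mul_add,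
      ← mul_assoc, orient_mul_self, one_mul]

/-- One step of the renormalized orbit, from the position `n` to the position `n'`. -/
def Renorm (j : Fin 6) (x : ℝ × ℝ) (b : ℤ → Arrow) (M : ℤ → ℝ) (n : ℤ) (a : Arrow) (n' : ℤ) :
    Prop :=
  n' = n + (subst j a).length ∧
    (∀ (m : ℕ) (hm : m < (subst j a).length), b (n + m) = (subst j a)[m]) ∧
    |M n| < width x.1 x.2 a.src ∧ |M n'| < width x.1 x.2 a.tgt ∧
    (b n).src = turn j a.src ∧ (b n').src = turn j a.tgt ∧
    orient j * M n' = orient j * M n + disp x.1 x.2 a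

theorem IsOrbit.exists_renorm {j : Fin 6} (hj : j ≠ 0) {x : ℝ × ℝ} (h1 : 0 ≤ x.1)
    (h2 : 0 ≤ x.2) {b : ℤ → Arrow} {M : ℤ → ℝ}
    (h : IsOrbit (liftParams j x).1 (liftParams j x).2 b M) {n : ℤ} {v : Fin 3}
    (hsrc : (b n).src = turn j v) (hM : |M n| < width x.1 x.2 v) :
    ∃ a n', a.src = v ∧ Renorm j x b M n a n' := by
  obtain ⟨a, rfl, ha⟩ := h.exists_arrow hj h1 h2 hsrc hM
  obtain ⟨h3, h4, h5⟩ := h.follow h1 h2 hsrc hM ha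
  refine ⟨a, _, rfl, rfl, h3, hM, ?_, hsrc, h4, h5⟩
  rwa [← h5, abs_orient_mul] at ha

/-- Time reversal negates the coordinate and conjugates the arrows, and `subst_conj` says that
blocks are compatible with it. Predecessors are successors for the reversed orbit. -/
theorem IsOrbit.exists_renorm_pred {j : Fin 6} (hj : j ≠ 0) {x : ℝ × ℝ} (h1 : 0 ≤ x.1)
    (h2 : 0 ≤ x.2) {b : ℤ → Arrow} {M : ℤ → ℝ}
    (h : IsOrbit (liftParams j x).1 (liftParams j x).2 b M) {n : ℤ} {v : Fin 3}
    (hsrc : (b n).src = turn j v) (hM : |M n| < width x.1 x.2 v) :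
    ∃ a n', a.tgt = v ∧ Renorm j x b M n' a n := by
  obtain ⟨a, n', rfl, hn', h3, -, h4, -, h5, h6⟩ := h.reverse.exists_renorm hj h1 h2 (n := -n)
    (v := v) (by rw [conj_src, h.1]; simpa using hsrc) (by simpa using hM)
  dsimp only at h3 h4 h5 h6
  rw [neg_neg] at h6
  rw [conj_src, h.1, sub_add_cancel] at h5
  rw [abs_neg] at h4
  refine ⟨a.conj, -n', conj_tgt a, ?_, fun m hm => ?_, ?_, ?_, ?_, ?_, ?_⟩
  · rw [subst_conj_length]; omega
  · have hm' : m < (subst j a).length := by rwa [subst_conj_length] at hm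
    have := congrArg Arrow.conj (h3 ((subst j a).length - 1 - m) (by omega))
    simp only [conj_conj] at this
    simp only [subst_conj, List.getElem_reverse, List.getElem_map, List.length_map]
    rw [← this]
    congr 1
    omega
  · rwa [conj_src]
  · rwa [conj_tgt]
  · rwa [conj_src]
  · rwa [conj_tgt]
  · rw [disp_conj]; linarith

/-- The positions whose points lie in the renormalized intervals are linked by blocks, forwards and
backwards. A turning position provides one of them, and the chain through it cuts the whole sequence
into blocks. -/
theorem IsCoding.exists_desubst {j : Fin 6} (hj : j ≠ 0) {x : ℝ × ℝ} (h1 : 0 ≤ x.1)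
    (h2 : 0 ≤ x.2) {b : ℤ → Arrow} (h : IsCoding (liftParams j x).1 (liftParams j x).2 b) :
    ∃ a, IsCoding x.1 x.2 a ∧ IsSubst j a b := by
  obtain ⟨M, h⟩ := h
  let S := {n : ℤ // ∃ v, (b n).src = turn j v ∧ |M n| < width x.1 x.2 v}
  let R : S → S → Prop := fun n n' => ∃ a, Renorm j x b M n a n'
  have hf : ∀ n, ∃ n', R n n' := by
    rintro ⟨n, v, hv, hM⟩
    obtain ⟨a, n', -, ha⟩ := h.exists_renorm hj h1 h2 hv hM
    exact ⟨⟨n', a.tgt, ha.2.2.2.2.2.1, ha.2.2.2.1⟩, a, ha⟩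
  have hb : ∀ n, ∃ n', R n' n := by
    rintro ⟨n, v, hv, hM⟩
    obtain ⟨a, n', -, ha⟩ := h.exists_renorm_pred hj h1 h2 hv hM
    exact ⟨⟨n', a.src, ha.2.2.2.2.1, ha.2.2.1⟩, a, ha⟩
  obtain ⟨n, hn⟩ := h.1.exists_turning
  have hS : ∃ v, (b (n + 1)).src = turn j v ∧ |M (n + 1)| < width x.1 x.2 v := by
    -- Since the arrow at `n + 1` is the conjugate of the arrow at `n`, it can be followed from `M
    -- (n + 1)` and, by reversal, from `-M (n + 1)`, where it leads to `-M n`.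
    refine abs_lt_of_turning hj h1 h2 (h.2 _).1 (h.abs_add_disp_lt _) ?_
    rw [hn, disp_conj, (h.2 n).2, conj_tgt]
    simpa using (h.2 n).1
  obtain ⟨n', hn'⟩ := hf ⟨n + 1, hS⟩
  obtain ⟨c, -, -, hc⟩ := exists_int_chain hf hb hn'
  choose a ha using hc
  refine ⟨a, ⟨fun n => orient j * M (c n), fun n => ?_, fun n => ⟨?_, (ha n).2.2.2.2.2.2⟩⟩,
    fun n => (c n : ℤ), fun n => ⟨(ha n).1, (ha n).2.1⟩⟩
  · exact turn_injective j ((ha n).2.2.2.2.2.1.symm.trans (ha (n + 1)).2.2.2.2.1)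
  · rw [abs_orient_mul]
    exact (ha n).2.2.1

theorem isCoding_lift_iff {j : Fin 6} (hj : j ≠ 0) {x : ℝ × ℝ} (h1 : 0 ≤ x.1)
    (h2 : 0 ≤ x.2) {b : ℤ → Arrow} :
    IsCoding (liftParams j x).1 (liftParams j x).2 b ↔ ∃ a, IsCoding x.1 x.2 a ∧ IsSubst j a b :=
  ⟨fun h => h.exists_desubst hj h1 h2, fun ⟨_, ha, hab⟩ => ha.lift h1 h2 hab⟩

/-! ### Sequences of parameters -/

/-- `x k` are the parameters of the `k`-th image of a direction with Farey expansion `s`. -/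
structure IsParams (s : ℕ → Fin 6) (x : ℕ → ℝ × ℝ) : Prop where
  ne_zero : ∀ k, s (k + 1) ≠ 0
  nonneg_fst : ∀ k, 0 ≤ (x k).1
  nonneg_snd : ∀ k, 0 ≤ (x k).2
  eq_lift : ∀ k, x k = liftParams (s (k + 1)) (x (k + 1))
  start_ne : x 0 ≠ 0

theorem IsParams.isCoding_iff {s : ℕ → Fin 6} {x : ℕ → ℝ × ℝ} (h : IsParams s x) (k : ℕ)
    {b : ℤ → Arrow} :
    IsCoding (x 0).1 (x 0).2 b ↔ ∃ a, IsCoding (x k).1 (x k).2 a ∧ IsSubstComp s k a b := by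
  induction k with
  | zero =>
    constructor
    · intro hb
      exact ⟨b, hb, rfl⟩
    · rintro ⟨a, ha, rfl⟩
      exact ha
  | succ k ih =>
    have hk : ∀ c, IsCoding (x k).1 (x k).2 c ↔
        ∃ a, IsCoding (x (k + 1)).1 (x (k + 1)).2 a ∧ IsSubst (s (k + 1)) a c := fun c => by
      rw [h.eq_lift k]
      exact isCoding_lift_iff (h.ne_zero k) (h.nonneg_fst _) (h.nonneg_snd _)
    rw [ih]
    constructor
    · rintro ⟨c, hc, hcb⟩
      obtain ⟨a, ha, hac⟩ := (hk c).1 hc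
      exact ⟨a, ha, c, hac, hcb⟩
    · rintro ⟨a, ha, c, hac, hcb⟩
      exact ⟨c, (hk c).2 ⟨a, ha, hac⟩, hcb⟩

theorem IsParams.ne (s : ℕ → Fin 6) (x : ℕ → ℝ × ℝ) (h : IsParams s x) (k : ℕ) : x k ≠ 0 := by
  induction k with
  | zero => exact h.start_ne
  | succ k ih =>
    intro h0
    apply ih
    rw [h.eq_lift k, h0]
    generalize s (k + 1) = j
    fin_cases j <;> simp [liftParams]

/-- Under the branch `1` the second parameter is preserved and is subtracted from the first at each
step. The first could not remain nonnegative if the second were positive. -/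
theorem IsParams.snd_eq_zero {s : ℕ → Fin 6} {x : ℕ → ℝ × ℝ} (h : IsParams s x) {K : ℕ}
    (hK : ∀ k, K ≤ k → s (k + 1) = 1) : (x K).2 = 0 := by
  have key : ∀ m : ℕ, (x (K + m)).2 = (x K).2 ∧ (x K).1 = (x (K + m)).1 + m * (x K).2 := by
    intro m
    induction m with
    | zero => simp
    | succ m ih =>
      have h1 := h.eq_lift (K + m)
      rw [hK _ (by omega)] at h1
      have h2 := congrArg Prod.fst h1
      have h3 := congrArg Prod.snd h1
      simp only [liftParams] at h2 h3
      rw [← add_assoc, ← h3]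
      refine ⟨ih.1, ?_⟩
      push_cast
      linarith [ih.1, ih.2]
  by_contra hne
  have hpos : 0 < (x K).2 := lt_of_le_of_ne (h.nonneg_snd K) (Ne.symm hne)
  obtain ⟨m, hm⟩ := exists_nat_gt ((x K).1 / (x K).2)
  rw [div_lt_iff₀ hpos] at hm
  linarith [(key m).2, h.nonneg_fst (K + m)]

theorem IsParams.fst_eq_zero {s : ℕ → Fin 6} {x : ℕ → ℝ × ℝ} (h : IsParams s x) {K : ℕ}
    (hK : ∀ k, K ≤ k → s (k + 1) = 5) : (x K).1 = 0 := by
  have key : ∀ m : ℕ, (x (K + m)).1 = (x K).1 ∧ (x K).2 = (x (K + m)).2 + m * (3 * (x K).1) := by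
    intro m
    induction m with
    | zero => simp
    | succ m ih =>
      have h1 := h.eq_lift (K + m)
      rw [hK _ (by omega)] at h1
      have h2 := congrArg Prod.fst h1
      have h3 := congrArg Prod.snd h1
      simp only [liftParams] at h2 h3
      rw [← add_assoc, ← h2]
      refine ⟨ih.1, ?_⟩
      push_cast
      linarith [ih.1, ih.2]
  by_contra hne
  have hpos : 0 < 3 * (x K).1 := by
    have := lt_of_le_of_ne (h.nonneg_fst K) (Ne.symm hne)
    linarith
  obtain ⟨m, hm⟩ := exists_nat_gt ((x K).2 / (3 * (x K).1))
  rw [div_lt_iff₀ hpos] at hm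
  linarith [(key m).2, h.nonneg_snd (K + m)]

/-- A vanishing first parameter propagates: for every branch except `5` it would make both
parameters of the next level vanish. The expansion would thus be constantly `5` from there on. -/
theorem IsParams.fst_pos {s : ℕ → Fin 6} {x : ℕ → ℝ × ℝ} (h : IsParams s x)
    (hs : ¬ Terminating s) (k : ℕ) : 0 < (x k).1 := by
  by_contra hle
  have h0 : (x k).1 = 0 := le_antisymm (not_lt.1 hle) (h.nonneg_fst k)
  have step : ∀ m, (x m).1 = 0 → s (m + 1) = 5 ∧ (x (m + 1)).1 = 0 := by
    intro m hm
    have h1 := h.eq_lift m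
    have h2 := h.nonneg_fst (m + 1)
    have h3 := h.nonneg_snd (m + 1)
    have h4 := h.ne s x (m + 1)
    have h5 := h.ne_zero m
    generalize s (m + 1) = j at *
    rw [h1] at hm
    have : (x (m + 1)).1 = 0 → (x (m + 1)).2 ≠ 0 := fun h6 h7 => h4 (Prod.ext h6 h7)
    fin_cases j <;> simp [liftParams] at hm h5 ⊢
    all_goals first
      | exact hm
      | exact this (by linarith) (by linarith)
  refine hs ⟨k + 1, Or.inr fun n hn => ?_⟩
  have key : ∀ m, (x (k + m)).1 = 0 := by
    intro m
    induction m with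
    | zero => exact h0
    | succ m ih => exact (step _ ih).2
  obtain ⟨m, rfl⟩ := Nat.exists_eq_add_of_le hn
  rw [add_right_comm]
  exact (step _ (key m)).1

theorem IsParams.snd_pos {s : ℕ → Fin 6} {x : ℕ → ℝ × ℝ} (h : IsParams s x)
    (hs : ¬ Terminating s) (k : ℕ) : 0 < (x k).2 := by
  by_contra hle
  have h0 : (x k).2 = 0 := le_antisymm (not_lt.1 hle) (h.nonneg_snd k)
  have step : ∀ m, (x m).2 = 0 → s (m + 1) = 1 ∧ (x (m + 1)).2 = 0 := by
    intro m hm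
    have h1 := h.eq_lift m
    have h2 := h.nonneg_fst (m + 1)
    have h3 := h.nonneg_snd (m + 1)
    have h4 := h.ne s x (m + 1)
    have h5 := h.ne_zero m
    generalize s (m + 1) = j at *
    rw [h1] at hm
    have : (x (m + 1)).1 = 0 → (x (m + 1)).2 ≠ 0 := fun h6 h7 => h4 (Prod.ext h6 h7)
    fin_cases j <;> simp [liftParams] at hm h5 ⊢
    all_goals first
      | exact hm
      | exact this (by linarith) (by linarith)
  refine hs ⟨k + 1, Or.inl fun n hn => ?_⟩
  have key : ∀ m, (x (k + m)).2 = 0 := by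
    intro m
    induction m with
    | zero => exact h0
    | succ m ih => exact (step _ ih).2
  obtain ⟨m, rfl⟩ := Nat.exists_eq_add_of_le hn
  rw [add_right_comm]
  exact (step _ (key m)).1

/-! ### Periodic words and terminating expansions -/

theorem subst_injective (i : Fin 6) : Function.Injective (subst i) := by
  revert i; decide

theorem subst_turns {i : Fin 6} (hi : i ≠ 0) {a a' y y' : Arrow} (h : a.tgt = a'.src)
    (hy : (subst i a)[(subst i a).length - 1]? = some y) (hy' : (subst i a')[0]? = some y') :
    y' = y.conj := by
  revert i a a' y y'; decide

theorem subst_not_turns {i : Fin 6} {a y y' : Arrow} {m : ℕ}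
    (hy : (subst i a)[m]? = some y) (hy' : (subst i a)[m + 1]? = some y') : y' ≠ y.conj := by
  have hm : m < 5 := by
    have := (List.getElem?_eq_some_iff.1 hy).1
    have := subst_length_le i a
    omega
  revert i a y y'
  interval_cases m <;> decide

/-- Recognizability: a path turns back at every junction of two blocks and never inside a block. The
cutting into blocks is thus determined by the sequence itself. -/
theorem IsConcat.turning_iff {i : Fin 6} (hi : i ≠ 0) {a b : ℤ → Arrow} {p : ℤ → ℤ}
    (h : IsConcat (subst i) a b p) (ha : IsPath a) (y : ℤ) :
    b y = (b (y - 1)).conj ↔ ∃ n, p n = y := by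
  constructor
  · intro hy
    obtain ⟨n, m, hm, rfl⟩ := h.exists_mem (subst_length_pos i) y
    rcases m with _ | m
    · exact ⟨n, by simp⟩
    · refine absurd hy (subst_not_turns (m := m) ?_ (h.getElem?_eq hm))
      rw [h.getElem?_eq (by omega)]
      congr 2
      push_cast; ring
  · rintro ⟨n, rfl⟩
    have h1 := (h (n - 1)).1
    have h2 := ha (n - 1)
    have h3 := subst_length_pos i (a (n - 1))
    rw [sub_add_cancel] at h1 h2
    refine subst_turns hi h2 ?_ (y' := b (p n)) ?_
    · rw [h.getElem?_eq (by omega)]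
      congr 2
      omega
    · simpa using h.getElem?_eq (subst_length_pos i (a n))

theorem strictMono_eq_of_range {f g : ℤ → ℤ} (hf : StrictMono f) (hg : StrictMono g)
    (h : Set.range f = Set.range g) (h0 : f 0 = g 0) : f = g := by
  have up : ∀ {f g : ℤ → ℤ}, StrictMono f → StrictMono g → Set.range f = Set.range g →
      ∀ n, f n = g n → g (n + 1) ≤ f (n + 1) := by
    intro f g hf hg h n hn
    obtain ⟨m, hm⟩ : f (n + 1) ∈ Set.range g := h ▸ Set.mem_range_self _
    rw [← hm]
    refine hg.monotone ?_
    have := hf (lt_add_one n)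
    rw [hn, ← hm] at this
    exact hg.lt_iff_lt.1 this
  have down : ∀ {f g : ℤ → ℤ}, StrictMono f → StrictMono g → Set.range f = Set.range g →
      ∀ n, f n = g n → f (n - 1) ≤ g (n - 1) := by
    intro f g hf hg h n hn
    obtain ⟨m, hm⟩ : f (n - 1) ∈ Set.range g := h ▸ Set.mem_range_self _
    rw [← hm]
    refine hg.monotone ?_
    have := hf (sub_one_lt n)
    rw [hn, ← hm] at this
    have := hg.lt_iff_lt.1 this
    omega
  funext n
  induction n using Int.induction_on with
  | zero => exact h0
  | succ k ih => exact le_antisymm (up hg hf h.symm _ ih.symm) (up hf hg h _ ih)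
  | pred k ih => exact le_antisymm (down hf hg h _ ih) (down hg hf h.symm _ ih.symm)

theorem add_le_of_strictMono {p : ℤ → ℤ} (hp : StrictMono p) (n : ℤ) {r : ℤ} (hr : 0 ≤ r) :
    p n + r ≤ p (n + r) := by
  lift r to ℕ using hr
  induction r with
  | zero => simp
  | succ r ih =>
    have := hp (show n + (r : ℤ) < n + (r + 1 : ℕ) by push_cast; omega)
    push_cast at this ⊢
    omega

/-- Translation by `P` preserves the turning positions, hence permutes the block starts in
increasing order and shifts their index by some `q`. The blocks then agree, and `subst i` is
injective on arrows. -/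
theorem IsConcat.exists_period {i : Fin 6} (hi : i ≠ 0) {a b : ℤ → Arrow} {p : ℤ → ℤ}
    (h : IsConcat (subst i) a b p) (ha : IsPath a) {P : ℤ} (hP : 0 < P)
    (hb : ∀ n, b (n + P) = b n) :
    ∃ q, 0 < q ∧ (∀ n, a (n + q) = a n) ∧ ∀ n, p (n + q) = p n + P := by
  have mono := h.strictMono (subst_length_pos i)
  have hT : ∀ y, (∃ n, p n = y + P) ↔ ∃ n, p n = y := fun y => by
    rw [← h.turning_iff hi ha, ← h.turning_iff hi ha, hb, add_sub_right_comm, hb]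
  obtain ⟨q, hq⟩ := (hT (p 0)).2 ⟨0, rfl⟩
  have hpq : (fun n => p (n + q)) = fun n => p n + P := by
    refine strictMono_eq_of_range (fun n m hnm => mono (by omega))
      (fun n m hnm => add_lt_add_left (mono hnm) P) ?_ (by simpa using hq)
    ext y
    constructor
    · rintro ⟨n, rfl⟩
      obtain ⟨m, hm⟩ := (hT (p (n + q) - P)).1 ⟨n + q, by ring⟩
      exact ⟨m, by dsimp only; omega⟩
    · rintro ⟨n, rfl⟩
      obtain ⟨m, hm⟩ := (hT (p n)).2 ⟨n, rfl⟩
      exact ⟨m - q, by simpa using hm⟩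
  have hpq' : ∀ n, p (n + q) = p n + P := fun n => congrFun hpq n
  refine ⟨q, ?_, fun n => ?_, hpq'⟩
  · exact mono.lt_iff_lt.1 (by omega)
  · apply subst_injective i
    have hlen : (subst i (a (n + q))).length = (subst i (a n)).length := by
      have h1 := (h n).1
      have h2 := (h (n + q)).1
      have h3 := hpq' (n + 1)
      rw [add_right_comm] at h3
      have h4 := hpq' n
      omega
    refine List.ext_getElem hlen fun m hm hm' => ?_
    rw [← (h n).2 m hm', ← (h (n + q)).2 m hm, hpq', add_right_comm, hb]

theorem IsConcat.periodic {X Y : Type*} {f : X → List Y} {a : ℤ → X} {b : ℤ → Y} {p : ℤ → ℤ}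
    (h : IsConcat f a b p) (hf : ∀ x, 0 < (f x).length) {q : ℤ} (hq : 0 < q)
    (ha : ∀ n, a (n + q) = a n) : ∃ P, 0 < P ∧ ∀ n, b (n + P) = b n := by
  have hp : ∀ n, p (n + q) = p n + (p q - p 0) := by
    intro n
    induction n using Int.induction_on with
    | zero => simp
    | succ k ih =>
      have h1 := (h (k + q)).1
      have h2 := (h k).1
      rw [ha, add_right_comm] at h1
      omega
    | pred k ih =>
      have h1 := (h (-k - 1 + q)).1
      have h2 := (h (-k - 1)).1
      rw [ha, add_right_comm, sub_add_cancel] at h1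
      rw [sub_add_cancel] at h2
      omega
  refine ⟨p q - p 0, sub_pos.2 (h.strictMono hf hq), fun y => ?_⟩
  obtain ⟨n, m, hm, rfl⟩ := h.exists_mem hf y
  have hm' : m < (f (a (n + q))).length := by rwa [ha]
  rw [add_right_comm, ← hp, (h n).2 m hm, (h (n + q)).2 m hm']
  simp only [ha]

theorem IsSubstComp.periodic {s : ℕ → Fin 6} {k : ℕ} {a b : ℤ → Arrow} (h : IsSubstComp s k a b)
    {q : ℤ} (hq : 0 < q) (ha : ∀ n, a (n + q) = a n) : ∃ P, 0 < P ∧ ∀ n, b (n + P) = b n := by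
  induction k generalizing a q with
  | zero =>
    obtain rfl : b = a := h
    exact ⟨q, hq, ha⟩
  | succ k ih =>
    obtain ⟨c, ⟨p, hc⟩, h⟩ := h
    obtain ⟨P, hP, hP'⟩ := IsConcat.periodic hc (subst_length_pos _) hq ha
    exact ih h hP hP'

theorem IsSubstComp.exists_period {s : ℕ → Fin 6} (hs : ∀ k, s (k + 1) ≠ 0) {k : ℕ}
    {a b : ℤ → Arrow} (h : IsSubstComp s k a b) (hb : IsPath b) {P : ℤ} (hP : 0 < P)
    (hb' : ∀ n, b (n + P) = b n) : ∃ q, 0 < q ∧ q ≤ P ∧ ∀ n, a (n + q) = a n := by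
  induction k generalizing a with
  | zero =>
    obtain rfl : b = a := h
    exact ⟨P, hP, le_rfl, hb'⟩
  | succ k ih =>
    have ha := h.isPath_of_isPath hb
    obtain ⟨c, ⟨p, hc⟩, h⟩ := h
    obtain ⟨Q, hQ, hQP, hQ'⟩ := ih h
    obtain ⟨q, hq, hq', hpq⟩ := IsConcat.exists_period (hs k) hc ha hQ hQ'
    have := add_le_of_strictMono (IsConcat.strictMono hc (subst_length_pos _)) 0 hq.le
    have := hpq 0
    exact ⟨q, hq, by omega, hq'⟩

theorem IsSubstComp.exists_split {s : ℕ → Fin 6} {k m : ℕ} {a b : ℤ → Arrow}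
    (h : IsSubstComp s (k + m) a b) :
    ∃ c, IsSubstComp (fun n => s (k + n)) m a c ∧ IsSubstComp s k c b := by
  induction m generalizing a with
  | zero => exact ⟨a, rfl, h⟩
  | succ m ih =>
    obtain ⟨d, hd, h⟩ := h
    obtain ⟨c, hc, hcb⟩ := ih h
    exact ⟨c, ⟨d, hd, hc⟩, hcb⟩

/-- The arrows which do not occur in the codings of the direction fixed by the `j`-th branch,
`j = 1, 5`, of the Farey map. -/
def Expanding (j : Fin 6) (a : Arrow) : Prop :=
  (j = 1 ∧ (a = w2 ∨ a = w2')) ∨ (j = 5 ∧ (a = w1 ∨ a = w3 ∨ a = w1'))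

instance (j : Fin 6) : DecidablePred (Expanding j) := fun a => by unfold Expanding; infer_instance

theorem Expanding.subst {j : Fin 6} {a : Arrow} (h : Expanding j a) :
    1 < (subst j a).length ∧ ∃ y ∈ subst j a, Expanding j y := by
  revert j a; decide

theorem not_expanding_subst {j : Fin 6} (hj : j = 1 ∨ j = 5) {a : Arrow} (h : ¬ Expanding j a) :
    ∀ y ∈ subst j a, ¬ Expanding j y := by
  revert j a; decide

theorem not_expanding_succ {j : Fin 6} (hj : j = 1 ∨ j = 5) {a a' a'' : Arrow}
    (h : ¬ Expanding j a) (h' : ¬ Expanding j a') (h'' : ¬ Expanding j a'') (h1 : a.tgt = a'.src)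
    (h2 : a'.tgt = a''.src) : a'' = a := by
  revert j a a' a''; decide

theorem IsSubstComp.not_expanding {s : ℕ → Fin 6} {j : Fin 6} (hj : j = 1 ∨ j = 5)
    (hs : ∀ k, s (k + 1) = j) {k : ℕ} {a b : ℤ → Arrow} (h : IsSubstComp s k a b)
    (ha : ∀ n, ¬ Expanding j (a n)) (n : ℤ) : ¬ Expanding j (b n) := by
  induction k generalizing a with
  | zero =>
    obtain rfl : b = a := h
    exact ha n
  | succ k ih =>
    obtain ⟨c, ⟨p, hc⟩, h⟩ := h
    rw [hs] at hc
    refine ih h fun y => ?_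
    obtain ⟨n, m, hm, rfl⟩ := IsConcat.exists_mem hc (subst_length_pos j) y
    rw [(hc n).2 m hm]
    exact not_expanding_subst hj (ha n) _ (List.getElem_mem hm)

/-- An expanding arrow has a block of length at least two that contains an expanding arrow again.
One period of `a` therefore gives a strictly longer period at each of the `k` levels. -/
theorem IsSubstComp.period_add_le {s : ℕ → Fin 6} {j : Fin 6} (hj : j = 1 ∨ j = 5)
    (hs : ∀ k, s (k + 1) = j) {k : ℕ} {a b : ℤ → Arrow} (h : IsSubstComp s k a b)
    (hb : IsPath b) {P : ℤ} (hP : 0 < P) (hb' : ∀ n, b (n + P) = b n)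
    (ha : ∃ n, Expanding j (a n)) : ∃ q, 0 < q ∧ q + k ≤ P ∧ ∀ n, a (n + q) = a n := by
  induction k generalizing a with
  | zero =>
    obtain rfl : b = a := h
    exact ⟨P, hP, by simp, hb'⟩
  | succ k ih =>
    have hpath := h.isPath_of_isPath hb
    obtain ⟨c, ⟨p, hc⟩, h⟩ := h
    rw [hs] at hc
    change IsConcat (subst j) a c p at hc
    obtain ⟨n, hn⟩ := ha
    obtain ⟨hlen, y, hy, hy'⟩ := hn.subst
    obtain ⟨m, hm, rfl⟩ := List.mem_iff_getElem.1 hy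
    obtain ⟨Q, hQ, hQk, hQ'⟩ := ih h ⟨p n + m, by rwa [(hc n).2 m hm]⟩
    have hj0 : j ≠ 0 := by rcases hj with rfl | rfl <;> decide
    obtain ⟨q, hq, hq', hpq⟩ := hc.exists_period hj0 hpath hQ hQ'
    refine ⟨q, hq, ?_, hq'⟩
    have mono := hc.strictMono (subst_length_pos j)
    -- Of the `q` blocks of one period, the one at `n` has length at least two and the others at
    -- least one, so `q + 1 ≤ Q`.
    have h1 := add_le_of_strictMono mono (n + 1) (show 0 ≤ q - 1 by omega)
    have h2 := (hc n).1
    have h3 := hpq n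
    rw [show n + 1 + (q - 1) = n + q by ring] at h1
    push_cast
    omega

/-- For `κ = 0` the displacement `3α` along `w2` and `w2'` is too large for the intervals, and the
other arrows do not move the point. The constant orbit at the centres realizes every remaining path.
-/
theorem isCoding_snd_zero_iff {α : ℝ} (hα : 0 < α) {a : ℤ → Arrow} :
    IsCoding α 0 a ↔ IsPath a ∧ ∀ n, ¬ Expanding 1 (a n) := by
  constructor
  · rintro ⟨M, h⟩
    refine ⟨h.1, fun n => ?_⟩
    have h1 := h.abs_add_disp_lt n
    have h0 := (h.2 n).1
    generalize a n = c at *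
    rw [abs_lt] at h0 h1
    cases c <;> simp [Expanding] <;> simp [disp, width, Arrow.src, Arrow.tgt] at h0 h1 <;> linarith
  · rintro ⟨h, h'⟩
    refine ⟨fun _ => 0, h, fun n => ?_⟩
    have := h' n
    generalize a n = c at *
    cases c <;> simp [Expanding] at this <;> simp [disp, width, Arrow.src, hα]

/-- For `α = 0` the interval at vertex `0` is empty and `w3` moves points by the full length of its
interval. Only `w2` and `w2'` remain, with zero displacement. -/
theorem isCoding_fst_zero_iff {κ : ℝ} (hκ : 0 < κ) {a : ℤ → Arrow} :
    IsCoding 0 κ a ↔ IsPath a ∧ ∀ n, ¬ Expanding 5 (a n) := by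
  constructor
  · rintro ⟨M, h⟩
    refine ⟨h.1, fun n => ?_⟩
    have h1 := h.abs_add_disp_lt n
    have h0 := (h.2 n).1
    generalize a n = c at *
    rw [abs_lt] at h0 h1
    cases c <;> simp [Expanding] <;> simp [disp, width, Arrow.src, Arrow.tgt] at h0 h1 <;> linarith
  · rintro ⟨h, h'⟩
    refine ⟨fun _ => 0, h, fun n => ?_⟩
    have := h' n
    generalize a n = c at *
    cases c <;> simp [Expanding] at this <;> simp [disp, width, Arrow.src, hκ]

theorem IsParams.exists_isCoding_iff {s : ℕ → Fin 6} {x : ℕ → ℝ × ℝ} (h : IsParams s x)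
    (hs : Terminating s) : ∃ (K : ℕ) (j : Fin 6), (j = 1 ∨ j = 5) ∧ (∀ k, s (K + (k + 1)) = j) ∧
      ∀ a, IsCoding (x K).1 (x K).2 a ↔ IsPath a ∧ ∀ n, ¬ Expanding j (a n) := by
  obtain ⟨K, hK | hK⟩ := hs
  · have h2 := h.snd_eq_zero (K := K) fun k hk => hK _ (by omega)
    refine ⟨K, 1, Or.inl rfl, fun k => hK _ (by omega), fun a => ?_⟩
    rw [h2]
    exact isCoding_snd_zero_iff
      (lt_of_le_of_ne (h.nonneg_fst K) fun h1 => h.ne s x K (Prod.ext h1.symm h2))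
  · have h2 := h.fst_eq_zero (K := K) fun k hk => hK _ (by omega)
    refine ⟨K, 5, Or.inr rfl, fun k => hK _ (by omega), fun a => ?_⟩
    rw [h2]
    exact isCoding_fst_zero_iff
      (lt_of_le_of_ne (h.nonneg_snd K) fun h1 => h.ne s x K (Prod.ext h2 h1.symm))

/-- Codings of directions with a terminating expansion. -/
theorem IsParams.isCoding_iff_periodic {s : ℕ → Fin 6} {x : ℕ → ℝ × ℝ} (h : IsParams s x)
    (hs : Terminating s) {b : ℤ → Arrow} : IsCoding (x 0).1 (x 0).2 b ↔
      IsPath b ∧ (∀ k, ∃ a, IsSubstComp s k a b) ∧ ∃ P : ℤ, 0 < P ∧ ∀ n, b (n + P) = b n := by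
  obtain ⟨K, j, hj, hsj, hK⟩ := h.exists_isCoding_iff hs
  constructor
  · intro hb
    refine ⟨hb.choose_spec.1, fun k => ?_, ?_⟩
    · obtain ⟨a, -, ha⟩ := (h.isCoding_iff k).1 hb
      exact ⟨a, ha⟩
    · obtain ⟨a, ha, hab⟩ := (h.isCoding_iff K).1 hb
      obtain ⟨ha, ha'⟩ := (hK a).1 ha
      refine hab.periodic two_pos fun n => ?_
      rw [show n + 2 = n + 1 + 1 by ring]
      exact not_expanding_succ hj (ha' n) (ha' (n + 1)) (ha' _) (ha n) (ha (n + 1))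
  · rintro ⟨hb, hG, P, hP, hb'⟩
    -- The depth is chosen beyond `K` by as many levels as the period: a period of `c` is at most
    -- `P`, so it cannot drop `P` times and stay positive.
    obtain ⟨a, hab⟩ := hG (K + P.toNat)
    obtain ⟨c, hac, hcb⟩ := hab.exists_split
    have hc := hcb.isPath_of_isPath hb
    refine (h.isCoding_iff K).2 ⟨c, (hK c).2 ⟨hc, ?_⟩, hcb⟩
    obtain ⟨q, hq, hqP, hcq⟩ := hcb.exists_period h.ne_zero hb hP hb'
    refine hac.not_expanding hj hsj fun n hn => ?_
    obtain ⟨r, hr, hr', -⟩ := hac.period_add_le hj hsj hc hq hcq ⟨n, hn⟩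
    omega

/-! ### Lengths of iterated substitutions -/

/-- The word `σ_{s 1} ⋯ σ_{s k} a`. -/
def iterSubst (s : ℕ → Fin 6) : ℕ → Arrow → List Arrow
  | 0, a => [a]
  | k + 1, a => (subst (s (k + 1)) a).flatMap (iterSubst s k)

theorem IsConcat.flatMap {X Y : Type*} {f : X → List Y} {c : ℤ → X} {b : ℤ → Y} {p : ℤ → ℤ}
    (h : IsConcat f c b p) (l : List X) (y : ℤ)
    (hl : ∀ (m : ℕ) (hm : m < l.length), c (y + m) = l[m]) :
    p (y + l.length) = p y + (l.flatMap f).length ∧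
      ∀ (m : ℕ) (hm : m < (l.flatMap f).length), b (p y + m) = (l.flatMap f)[m] := by
  induction l generalizing y with
  | nil => simp
  | cons z l ih =>
    have hz : c y = z := by
      have := hl 0 (by simp)
      rwa [List.getElem_cons_zero, Nat.cast_zero, add_zero] at this
    have ht := ih (y + 1) fun m hm => by
      have := hl (m + 1) (by simpa using hm)
      push_cast at this
      rwa [List.getElem_cons_succ, add_comm (m : ℤ), ← add_assoc] at this
    have hy := h y
    rw [hz] at hy
    refine ⟨?_, fun m hm => ?_⟩
    · rw [List.flatMap_cons, List.length_append, List.length_cons]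
      push_cast
      rw [add_comm (l.length : ℤ), ← add_assoc, ht.1, hy.1]
      ring
    · simp only [List.flatMap_cons, List.getElem_append]
      split_ifs with hm'
      · exact hy.2 m hm'
      · have := ht.2 (m - (f z).length) (by
          rw [List.flatMap_cons, List.length_append] at hm
          omega)
        rw [← this, hy.1]
        congr 1
        omega

theorem IsConcat.comp {X Y Z : Type*} {g : X → List Y} {f : Y → List Z} {a : ℤ → X} {c : ℤ → Y}
    {b : ℤ → Z} {q p : ℤ → ℤ} (h : IsConcat g a c q) (h' : IsConcat f c b p) :
    IsConcat (fun x => (g x).flatMap f) a b fun n => p (q n) := by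
  intro n
  dsimp only
  rw [(h n).1]
  exact h'.flatMap _ _ (h n).2

theorem IsSubstComp.isConcat {s : ℕ → Fin 6} {k : ℕ} {a b : ℤ → Arrow}
    (h : IsSubstComp s k a b) : ∃ p, IsConcat (iterSubst s k) a b p := by
  induction k generalizing a with
  | zero =>
    obtain rfl : b = a := h
    exact ⟨id, fun n => ⟨by simp [iterSubst], fun m hm => by
      obtain rfl : m = 0 := by simpa [iterSubst] using hm
      simp [iterSubst]⟩⟩
  | succ k ih =>
    obtain ⟨c, ⟨q, hc⟩, h⟩ := h
    obtain ⟨p, hp⟩ := ih h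
    exact ⟨_, IsConcat.comp hc hp⟩

theorem iterSubst_length (s : ℕ → Fin 6) (k : ℕ) (a : Arrow) :
    (iterSubst s (k + 1) a).length =
      ((subst (s (k + 1)) a).map fun y => (iterSubst s k y).length).sum := by
  simp [iterSubst, List.length_flatMap]

theorem le_iterSubst_succ {s : ℕ → Fin 6} {k L : ℕ} (h : ∀ a, L ≤ (iterSubst s k a).length)
    (a : Arrow) : L ≤ (iterSubst s (k + 1) a).length := by
  rw [iterSubst_length]
  generalize s (k + 1) = j
  have h1 := h w1
  have h2 := h w2
  have h3 := h w3
  have h4 := h w2'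
  have h5 := h w1'
  fin_cases j <;> cases a <;> simp [subst] <;> omega

theorem le_iterSubst_add {s : ℕ → Fin 6} {k L : ℕ} (h : ∀ a, L ≤ (iterSubst s k a).length)
    (m : ℕ) (a : Arrow) : L ≤ (iterSubst s (k + m) a).length := by
  induction m generalizing a with
  | zero => exact h a
  | succ m ih => exact le_iterSubst_succ ih a

theorem lt_iterSubst_succ {s : ℕ → Fin 6} {k L : ℕ} (hL : 0 < L)
    (h : ∀ a, L ≤ (iterSubst s k a).length)
    (hj : s (k + 1) = 2 ∨ s (k + 1) = 3 ∨ s (k + 1) = 4) (a : Arrow) :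
    L < (iterSubst s (k + 1) a).length := by
  rw [iterSubst_length]
  have h1 := h w1
  have h2 := h w2
  have h3 := h w3
  have h4 := h w2'
  have h5 := h w1'
  rcases hj with hj | hj | hj <;> rw [hj] <;> cases a <;> simp [subst] <;> omega

/-- The arrows with a one-letter block under `σ_1` are `w1`, `w3`, `w1'`, and under `σ_5` they are
`w2`, `w2'`. The one-letter images under either substitution are lengthened by the other. -/
theorem lt_iterSubst_add_two {s : ℕ → Fin 6} {k L : ℕ} (hL : 0 < L)
    (h : ∀ a, L ≤ (iterSubst s k a).length)
    (hj : (s (k + 1) = 1 ∧ s (k + 1 + 1) = 5) ∨ (s (k + 1) = 5 ∧ s (k + 1 + 1) = 1)) (a : Arrow) :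
    L < (iterSubst s (k + 1 + 1) a).length := by
  rw [iterSubst_length]
  simp only [iterSubst_length s k]
  have h1 := h w1
  have h2 := h w2
  have h3 := h w3
  have h4 := h w2'
  have h5 := h w1'
  rcases hj with ⟨hj, hj'⟩ | ⟨hj, hj'⟩ <;> rw [hj, hj'] <;> cases a <;> simp [subst] <;> omega

/-- The minimal length never decreases. It grows at each index `2`, `3`, `4` and at each change
between `1` and `5`; if it stopped growing, the expansion would be eventually constant. -/
theorem exists_le_iterSubst {s : ℕ → Fin 6} (h0 : ∀ k, s (k + 1) ≠ 0) (hs : ¬ Terminating s)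
    (L : ℕ) : ∃ k, ∀ a, L < (iterSubst s k a).length := by
  induction L with
  | zero => exact ⟨0, fun a => by simp [iterSubst]⟩
  | succ L ih =>
    obtain ⟨k, hk⟩ := ih
    by_contra! hne
    have h15 : ∀ n, s (k + n + 1) = 1 ∨ s (k + n + 1) = 5 := by
      intro n
      by_contra hcon
      obtain ⟨a, ha⟩ := hne (k + n + 1)
      refine absurd (lt_iterSubst_succ (Nat.succ_pos L) (fun a => le_iterSubst_add hk n a) ?_ a)
        (not_lt.2 ha)
      have := h0 (k + n)
      generalize s (k + n + 1) = j at *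
      revert j; decide
    have hstep : ∀ n, s (k + n + 1 + 1) = s (k + n + 1) := by
      intro n
      by_contra hcon
      obtain ⟨a, ha⟩ := hne (k + n + 1 + 1)
      refine absurd (lt_iterSubst_add_two (Nat.succ_pos L) (fun a => le_iterSubst_add hk n a) ?_ a)
        (not_lt.2 ha)
      have h1 := h15 n
      have h2 := h15 (n + 1)
      rw [← add_assoc] at h2
      generalize s (k + n + 1) = j at *
      generalize s (k + n + 1 + 1) = j' at *
      rcases h1 with rfl | rfl <;> rcases h2 with rfl | rfl <;> simp at hcon ⊢
    have hconst : ∀ n, s (k + n + 1) = s (k + 1) := by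
      intro n
      induction n with
      | zero => rfl
      | succ n ih => rw [← ih, ← hstep n]; rfl
    refine hs ⟨k + 1, ?_⟩
    refine (h15 0).imp (fun h1 n hn => ?_) (fun h1 n hn => ?_) <;>
    · obtain ⟨m, rfl⟩ := Nat.exists_eq_add_of_le hn
      rw [add_right_comm, hconst]
      exact h1

/-! ### Codings through a given arrow -/

/-- The integral combinations of the parameters. -/
def lattice (α κ : ℝ) : AddSubgroup ℝ := AddSubgroup.closure {α, κ}

theorem countable_lattice (α κ : ℝ) : (lattice α κ : Set ℝ).Countable := by
  have : (lattice α κ : Set ℝ) ⊆ Set.range fun z : ℤ × ℤ => z.1 * α + z.2 * κ := by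
    intro t ht
    obtain ⟨m, n, h⟩ := AddSubgroup.mem_closure_pair.1 ht
    exact ⟨(m, n), by simpa using h⟩
  exact (Set.countable_range _).mono this

theorem mem_lattice (α κ : ℝ) (m n : ℤ) : m * α + n * κ ∈ lattice α κ :=
  AddSubgroup.mem_closure_pair.2 ⟨m, n, by simp⟩

theorem disp_mem_lattice (α κ : ℝ) (a : Arrow) : disp α κ a ∈ lattice α κ := by
  cases a <;> simp only [disp]
  · simpa using mem_lattice α κ 0 (-1)
  · simpa using mem_lattice α κ 3 0
  · simpa using mem_lattice α κ 0 (-2)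
  · simpa using mem_lattice α κ 3 0
  · simpa using mem_lattice α κ 0 (-1)

theorem exists_arrow_of_notMem {α κ t : ℝ} (hα : 0 < α) (hκ : 0 < κ) (ht : t ∉ lattice α κ)
    {v : Fin 3} (hv : |t| < width α κ v) :
    ∃ a : Arrow, a.src = v ∧ |t + disp α κ a| < width α κ a.tgt := by
  have ht1 : t ≠ κ - α := by
    rintro rfl
    exact ht (by simpa [neg_add_eq_sub] using mem_lattice α κ (-1) 1)
  have ht2 : t ≠ κ - 2 * α := by
    rintro rfl
    exact ht (by simpa [neg_add_eq_sub] using mem_lattice α κ (-2) 1)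
  rw [abs_lt] at hv
  obtain ⟨hv1, hv2⟩ := hv
  fin_cases v <;> simp [width] at hv1 hv2
  · refine ⟨w1, rfl, ?_⟩
    simp [abs_lt, disp, width, Arrow.tgt]
    constructor <;> linarith
  · rcases lt_or_gt_of_ne ht1 with ht | ht
    · refine ⟨w2, rfl, ?_⟩
      simp [abs_lt, disp, width, Arrow.tgt]
      constructor <;> linarith
    · refine ⟨w1', rfl, ?_⟩
      simp [abs_lt, disp, width, Arrow.tgt]
      constructor <;> linarith
  · rcases lt_or_gt_of_ne ht2 with ht | ht
    · refine ⟨w2', rfl, ?_⟩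
      simp [abs_lt, disp, width, Arrow.tgt]
      constructor <;> linarith
    · refine ⟨w3, rfl, ?_⟩
      simp [abs_lt, disp, width, Arrow.tgt]
      constructor <;> linarith

theorem exists_point {α κ : ℝ} (hα : 0 < α) (hκ : 0 < κ) (a : Arrow) :
    ∃ t, t ∉ lattice α κ ∧ |t| < width α κ a.src ∧ |t + disp α κ a| < width α κ a.tgt := by
  obtain ⟨l, u, hlu, h⟩ : ∃ l u, l < u ∧ ∀ t ∈ Set.Ioo l u,
      |t| < width α κ a.src ∧ |t + disp α κ a| < width α κ a.tgt := by
    cases a <;> simp only [disp, width, Arrow.src, Arrow.tgt, abs_lt, Set.mem_Ioo] <;>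
      simp only [Matrix.cons_val]
    · exact ⟨-α, α, by linarith, fun t ⟨h1, h2⟩ =>
        ⟨⟨by linarith, by linarith⟩, by linarith, by linarith⟩⟩
    · exact ⟨-α - κ, κ - α, by linarith, fun t ⟨h1, h2⟩ =>
        ⟨⟨by linarith, by linarith⟩, by linarith, by linarith⟩⟩
    · exact ⟨κ - 2 * α, 2 * α + κ, by linarith, fun t ⟨h1, h2⟩ =>
        ⟨⟨by linarith, by linarith⟩, by linarith, by linarith⟩⟩
    · exact ⟨-2 * α - κ, κ - 2 * α, by linarith, fun t ⟨h1, h2⟩ =>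
        ⟨⟨by linarith, by linarith⟩, by linarith, by linarith⟩⟩
    · exact ⟨κ - α, α + κ, by linarith, fun t ⟨h1, h2⟩ =>
        ⟨⟨by linarith, by linarith⟩, by linarith, by linarith⟩⟩
  obtain ⟨t, ht, ht'⟩ := (countable_lattice α κ).dense_compl ℝ |>.exists_between hlu
  exact ⟨t, ht, h t ht'⟩

/-- The points that may follow `a` contain an open interval, so one of them avoids the countable
group generated by `α` and `κ`. Displacements and singular points belong to this group, so its orbit
continues forever in both directions. -/
theorem exists_isCoding {α κ : ℝ} (hα : 0 < α) (hκ : 0 < κ) (a : Arrow) :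
    ∃ b, IsCoding α κ b ∧ b 0 = a := by
  let S := {z : Fin 3 × ℝ // z.2 ∉ lattice α κ ∧ |z.2| < width α κ z.1}
  let R : S → S → Prop := fun z z' => ∃ a : Arrow, a.src = z.1.1 ∧ a.tgt = z'.1.1 ∧
    z'.1.2 = z.1.2 + disp α κ a
  have hf : ∀ z, ∃ z', R z z' := by
    rintro ⟨⟨v, t⟩, ht, hv⟩
    obtain ⟨a, rfl, ha⟩ := exists_arrow_of_notMem hα hκ ht hv
    exact ⟨⟨(a.tgt, t + disp α κ a),
      fun h => ht ((AddSubgroup.add_mem_cancel_right _ (disp_mem_lattice α κ a)).1 h), ha⟩,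
      a, rfl, rfl, rfl⟩
  have hb : ∀ z, ∃ z', R z' z := by
    rintro ⟨⟨v, t⟩, ht, hv⟩
    obtain ⟨a, rfl, ha⟩ := exists_arrow_of_notMem hα hκ (t := -t) (by simpa using ht)
      (by simpa using hv)
    refine ⟨⟨(a.tgt, t - disp α κ a),
      fun h => ht (by simpa using add_mem h (disp_mem_lattice α κ a)), ?_⟩,
      a.conj, conj_src a, conj_tgt a, ?_⟩
    · rw [← abs_neg, neg_sub, ← neg_add_eq_sub]
      exact ha
    · simp [disp_conj]
  obtain ⟨t, ht, h1, h2⟩ := exists_point hα hκ a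
  obtain ⟨c, h0, h1, hc⟩ := exists_int_chain hf hb (x := ⟨(a.src, t), ht, h1⟩)
    (y := ⟨(a.tgt, t + disp α κ a),
      fun h => ht ((AddSubgroup.add_mem_cancel_right _ (disp_mem_lattice α κ a)).1 h), h2⟩)
    ⟨a, rfl, rfl, rfl⟩
  choose b hb using hc
  refine ⟨b, ⟨fun n => (c n).1.2, fun n => ?_, fun n => ⟨?_, (hb n).2.2⟩⟩, ?_⟩
  · rw [(hb n).2.1, (hb (n + 1)).1]
  · rw [(hb n).1]
    exact (c n).2.2
  · apply Arrow.eq_of_src_tgt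
    · rw [(hb 0).1, h0]
    · rw [(hb 0).2.1, zero_add, h1]

theorem IsCoding.shift {α κ : ℝ} {b : ℤ → Arrow} (h : IsCoding α κ b) (t : ℤ) :
    IsCoding α κ fun n => b (n + t) := by
  obtain ⟨M, hb, hM⟩ := h
  refine ⟨fun n => M (n + t), fun n => ?_, fun n => ⟨(hM _).1, ?_⟩⟩
  · rw [hb]
    congr 2; ring
  · rw [← (hM _).2, add_right_comm]

theorem exists_isSubstComp (s : ℕ → Fin 6) (k : ℕ) (a : ℤ → Arrow) :
    ∃ b, IsSubstComp s k a b := by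
  induction k generalizing a with
  | zero => exact ⟨a, rfl⟩
  | succ k ih =>
    obtain ⟨c, p, hc⟩ := exists_isConcat (subst_length_pos (s (k + 1))) a
    obtain ⟨b, hb⟩ := ih c
    exact ⟨b, c, ⟨p, hc⟩, hb⟩

/-! ### Approximation by codings -/

theorem subst_head_eq {j : Fin 6} (hj : j ≠ 0) {a a' y y' : Arrow} (h : a.src = a'.src)
    (hy : (subst j a)[0]? = some y) (hy' : (subst j a')[0]? = some y') : y = y' := by
  revert j a a' y y'; decide

/-- Any two consecutive arrows of a path which can be desubstituted occur in a coding. -/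
theorem IsParams.exists_pair {s : ℕ → Fin 6} {x : ℕ → ℝ × ℝ} (h : IsParams s x)
    (hs : ¬ Terminating s) {k : ℕ} {e c : ℤ → Arrow} (he : IsPath e)
    (hec : IsSubst (s (k + 1)) e c) (n : ℤ) :
    ∃ c', IsCoding (x k).1 (x k).2 c' ∧ ∃ n', c' n' = c n ∧ c' (n' + 1) = c (n + 1) := by
  obtain ⟨q, hq⟩ := hec
  change IsConcat (subst (s (k + 1))) e c q at hq
  have hlift : ∀ {e' c' : ℤ → Arrow}, IsCoding (x (k + 1)).1 (x (k + 1)).2 e' →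
      IsSubst (s (k + 1)) e' c' → IsCoding (x k).1 (x k).2 c' := fun he' hc' => by
    rw [h.eq_lift k]
    exact he'.lift (h.nonneg_fst _) (h.nonneg_snd _) hc'
  obtain ⟨r, t, ht, rfl⟩ := hq.exists_mem (subst_length_pos _) n
  by_cases ht' : t + 1 < (subst (s (k + 1)) (e r)).length
  · obtain ⟨e', he', he0⟩ := exists_isCoding (h.fst_pos hs (k + 1)) (h.snd_pos hs (k + 1)) (e r)
    obtain ⟨c', q', hq'⟩ := exists_isConcat (subst_length_pos (s (k + 1))) e'
    refine ⟨c', hlift he' ⟨q', hq'⟩, q' 0 + t, ?_, ?_⟩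
    · rw [(hq r).2 t ht, (hq' 0).2 t (by rwa [he0])]
      simp only [he0]
    · have h1 := (hq r).2 (t + 1) ht'
      have h2 := (hq' 0).2 (t + 1) (by rwa [he0])
      push_cast at h1 h2
      rw [add_assoc, add_assoc, h1, h2]
      simp only [he0]
  -- At a junction the pair is determined by its second arrow, as the path turns back there. That
  -- arrow is the first of the block of `e (r + 1)`, so a coding through `e (r + 1)` suffices.
  · obtain ⟨e', he', he0⟩ := exists_isCoding (h.fst_pos hs (k + 1)) (h.snd_pos hs (k + 1))
      (e (r + 1))
    obtain ⟨c', q', hq'⟩ := exists_isConcat (subst_length_pos (s (k + 1))) e'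
    have hr : q r + t + 1 = q (r + 1) := by rw [(hq r).1]; omega
    have hturn := (hq.turning_iff (h.ne_zero k) he (q (r + 1))).2 ⟨_, rfl⟩
    have hturn' := (hq'.turning_iff (h.ne_zero k) he'.choose_spec.1 (q' 0)).2 ⟨_, rfl⟩
    have heq : c' (q' 0) = c (q (r + 1)) := by
      refine subst_head_eq (h.ne_zero k) (a := e' 0) (a' := e (r + 1)) (by rw [he0]) ?_ ?_
      · simpa using hq'.getElem?_eq (subst_length_pos _ (e' 0))
      · simpa using hq.getElem?_eq (subst_length_pos _ (e (r + 1)))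
    refine ⟨c', hlift he' ⟨q', hq'⟩, q' 0 - 1, ?_, ?_⟩
    · rw [heq, hturn] at hturn'
      have := congrArg Arrow.conj hturn'
      rw [conj_conj, conj_conj, ← hr, add_sub_cancel_right] at this
      exact this.symm
    · rw [sub_add_cancel, heq, hr]

/-- At a level where all blocks are longer than `2N`, the window lies in two consecutive blocks.
Desubstituting once more shows that this pair of arrows occurs in a coding, whose image agrees with
`b` on the window after a shift. -/
theorem IsParams.exists_approx {s : ℕ → Fin 6} {x : ℕ → ℝ × ℝ} (h : IsParams s x)
    (hs : ¬ Terminating s) {b : ℤ → Arrow} (hb : IsPath b)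
    (hG : ∀ k, ∃ a, IsSubstComp s k a b) (N : ℕ) :
    ∃ b', IsCoding (x 0).1 (x 0).2 b' ∧ ∀ n, -(N : ℤ) ≤ n → n ≤ N → b' n = b n := by
  obtain ⟨k, hk⟩ := exists_le_iterSubst h.ne_zero hs (2 * N)
  have hpos : ∀ a, 0 < (iterSubst s k a).length := fun a => (Nat.zero_le _).trans_lt (hk a)
  obtain ⟨e, c, hec, hcb⟩ := hG (k + 1)
  have he : IsPath e := IsSubstComp.isPath_of_isPath (k := k + 1) ⟨c, hec, hcb⟩ hb
  obtain ⟨p, hp⟩ := hcb.isConcat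
  obtain ⟨n, m, hm, hN⟩ := hp.exists_mem hpos (-(N : ℤ))
  obtain ⟨c', hc', n', h1, h2⟩ := h.exists_pair hs he hec n
  obtain ⟨b', hb'⟩ := exists_isSubstComp s k c'
  obtain ⟨p', hp'⟩ := hb'.isConcat
  have key : ∀ r : ℕ, r < (iterSubst s k (c n)).length + (iterSubst s k (c (n + 1))).length →
      b' (p' n' + r) = b (p n + r) := by
    intro r hr
    by_cases hr' : r < (iterSubst s k (c n)).length
    · rw [(hp n).2 r hr', (hp' n').2 r (by rwa [h1])]
      simp only [h1]
    · obtain ⟨r, rfl⟩ := Nat.exists_eq_add_of_le (not_lt.1 hr')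
      have e1 := (hp n).1
      have e2 := (hp' n').1
      rw [h1] at e2
      push_cast
      rw [← add_assoc, ← add_assoc, ← e1, ← e2, (hp (n + 1)).2 r (by omega),
        (hp' (n' + 1)).2 r (by rw [h2]; omega)]
      simp only [h2]
  refine ⟨_, ((h.isCoding_iff k).2 ⟨c', hc', hb'⟩).shift (p' n' - p n), fun y hy hy' => ?_⟩
  have := hk (c (n + 1))
  have := key (y - p n).toNat (by omega)
  rw [show p' n' + ((y - p n).toNat : ℤ) = y + (p' n' - p n) by omega,
    show p n + ((y - p n).toNat : ℤ) = y by omega] at this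
  exact this

/-! ### Limits of desubstitutions -/

theorem exists_eventually_eq {α : Type*} (u : Ultrafilter ℕ) {f : ℕ → α} {T : Set α}
    (hT : T.Finite) (hf : ∀ i, f i ∈ T) : ∃ v, ∀ᶠ i in (u : Filter ℕ), f i = v := by
  have hmem : T ∈ u.map f :=
    Ultrafilter.mem_map.2 (Filter.Eventually.of_forall (f := (u : Filter ℕ)) hf)
  obtain ⟨v, -, hv⟩ := Ultrafilter.eq_pure_of_finite_mem hT hmem
  refine ⟨v, ?_⟩
  have : {v} ∈ u.map f := by rw [hv]; exact Set.mem_singleton v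
  exact this

theorem exists_limit_desubst {j : Fin 6} (u : Ultrafilter ℕ) {a b : ℕ → ℤ → Arrow}
    (h : ∀ i, IsSubst j (a i) (b i)) {b' : ℤ → Arrow}
    (hb : ∀ n, ∀ᶠ i in (u : Filter ℕ), b i n = b' n) :
    ∃ (t : ℕ → ℤ) (a' : ℤ → Arrow), (∀ n, ∀ᶠ i in (u : Filter ℕ), a i (n + t i) = a' n) ∧
      IsSubst j a' b' := by
  choose p hp using h
  choose t m hm h0 using fun i => IsConcat.exists_mem (hp i) (subst_length_pos j) 0
  choose a' ha' using fun n => exists_eventually_eq u (f := fun i => a i (n + t i))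
    Set.finite_univ fun _ => Set.mem_univ _
  -- The block containing the position `0` starts a bounded distance before it, so its start is
  -- constant along the ultrafilter. This anchors all the other blocks in the limit.
  obtain ⟨p0, hp0⟩ := exists_eventually_eq u (f := fun i => p i (t i)) (Set.finite_Icc (-5) 0)
    fun i => by
      have := hm i
      have := subst_length_le j (a i (t i))
      have := h0 i
      constructor <;> omega
  obtain ⟨q, hq⟩ := exists_block_starts fun n => (subst j (a' n)).length
  have hlim : ∀ n, ∀ᶠ i in (u : Filter ℕ), p i (n + t i) = q n + (p0 - q 0) := by
    intro n
    induction n using Int.induction_on with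
    | zero =>
      filter_upwards [hp0] with i hi
      rw [zero_add, hi]; ring
    | succ k ih =>
      filter_upwards [ih, ha' k] with i hi hi'
      have h1 := (hp i (k + t i)).1
      rw [hi', add_right_comm] at h1
      have := hq k
      omega
    | pred k ih =>
      filter_upwards [ih, ha' (-k - 1)] with i hi hi'
      have h1 := (hp i (-k - 1 + t i)).1
      rw [hi', add_right_comm, sub_add_cancel] at h1
      have := hq (-k - 1)
      rw [sub_add_cancel] at this
      omega
  refine ⟨t, a', ha', fun n => q n + (p0 - q 0), fun n => ⟨?_, fun r hr => ?_⟩⟩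
  · dsimp only
    rw [hq]; ring
  · obtain ⟨i, h1, h2, h3⟩ := ((hlim n).and ((ha' n).and (hb (q n + (p0 - q 0) + r)))).exists
    rw [← h3, ← h1, (hp i _).2 r (by rwa [h2])]
    simp only [h2]

theorem exists_limit_substComp {s : ℕ → Fin 6} (u : Ultrafilter ℕ) {k : ℕ}
    {a b : ℕ → ℤ → Arrow} (h : ∀ i, IsSubstComp s k (a i) (b i)) {b' : ℤ → Arrow}
    (hb : ∀ n, ∀ᶠ i in (u : Filter ℕ), b i n = b' n) :
    ∃ (t : ℕ → ℤ) (a' : ℤ → Arrow), (∀ n, ∀ᶠ i in (u : Filter ℕ), a i (n + t i) = a' n) ∧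
      IsSubstComp s k a' b' := by
  induction k generalizing a with
  | zero => exact ⟨0, b', fun n => by simpa [show b = a from funext h] using hb n, rfl⟩
  | succ k ih =>
    choose c hac hcb using h
    obtain ⟨t, c', hc, hcb'⟩ := ih hcb
    have hac' : ∀ i, IsSubst (s (k + 1)) (a i) fun n => c i (n + t i) := fun i => by
      obtain ⟨p, hp⟩ := hac i
      have := IsConcat.shift hp 0 (t i)
      simp only [add_zero] at this
      exact isSubst_iff.2 ⟨_, this⟩
    obtain ⟨r, a', ha, hac''⟩ := exists_limit_desubst u hac' hc
    exact ⟨r, a', ha, c', hac'', hcb'⟩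

open Filter Topology in
/-- The closure of a set of words read on codings. -/
theorem IsParams.mem_closure_iff {s : ℕ → Fin 6} {x : ℕ → ℝ × ℝ} (h : IsParams s x)
    (hs : ¬ Terminating s) {S : Set Word}
    (hS : ∀ w, w ∈ S ↔ ∃ b, IsReading (s 0) b w ∧ IsCoding (x 0).1 (x 0).2 b) (w : Word) :
    w ∈ closure S ↔ InSubstIntersection s w := by
  constructor
  · intro hw
    obtain ⟨v, hv, hlim⟩ := mem_closure_iff_seq_limit.1 hw
    have hlim' : ∀ n, ∀ᶠ i in atTop, v i n = w n := fun n => by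
      have := tendsto_pi_nhds.1 hlim n
      rwa [nhds_discrete, tendsto_pure] at this
    choose b hb hcod using fun i => (hS _).1 (hv i)
    -- Along an ultrafilter every finitely valued sequence is eventually constant, so all
    -- coordinates converge at once without extracting subsequences.
    let u : Ultrafilter ℕ := Ultrafilter.of atTop
    have hlim'' : ∀ n, ∀ᶠ i in (u : Filter ℕ), v i n = w n := fun n =>
      Ultrafilter.of_le atTop (hlim' n)
    choose b' hb' using fun n => exists_eventually_eq u (f := fun i => b i n)
      Set.finite_univ fun _ => Set.mem_univ _
    have hread : IsReading (s 0) b' w := fun n => by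
      obtain ⟨i, h1, h2, h3⟩ := ((hb' n).and ((hlim'' n).and (hlim'' (n + 1)))).exists
      rw [← h1, ← h2, ← h3]
      exact hb i n
    intro k
    choose a _ hab using fun i => (h.isCoding_iff k).1 (hcod i)
    obtain ⟨-, a', -, ha'⟩ := exists_limit_substComp u hab hb'
    exact ⟨a', b', ha', hread⟩
  · intro hw
    obtain ⟨-, b, -, hb⟩ := hw 0
    have hG : ∀ k, ∃ a, IsSubstComp s k a b := fun k => by
      obtain ⟨a, b', hab, hb'⟩ := hw k
      exact ⟨a, hb.eq hb' ▸ hab⟩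
    choose b' hcod hb' using h.exists_approx hs (isReading_iff.1 hb).1 hG
    refine mem_closure_of_tendsto (f := fun (N : ℕ) (n : ℤ) => vertex (s 0) (b' N n).src)
      (b := atTop) (tendsto_pi_nhds.2 fun n => ?_) (Eventually.of_forall fun N => (hS _).2
        ⟨b' N, isReading_iff.2 ⟨(hcod N).choose_spec.1, fun _ => rfl⟩, hcod N⟩)
    rw [nhds_discrete, tendsto_pure]
    filter_upwards [eventually_ge_atTop n.natAbs] with N hN
    rw [hb' N n (by omega) (by omega), (isReading_iff.1 hb).2]

/-! ### Coordinates -/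

theorem normal_zero : normal 0 = ![Real.sqrt 3 / 2, 1 / 2] := by
  simp [normal, dir]

theorem normal_one : normal 1 = ![0, 1] := by
  have h : Real.pi / 6 + Real.pi / 3 = Real.pi / 2 := by ring
  simp [normal, dir, h]

theorem normal_two : normal 2 = ![-(Real.sqrt 3 / 2), 1 / 2] := by
  have h : Real.pi / 6 + 2 * (Real.pi / 3) = Real.pi - Real.pi / 6 := by ring
  simp [normal, dir, h, Real.cos_pi_sub, Real.sin_pi_sub]

theorem normal_three : normal 3 = ![-(Real.sqrt 3 / 2), -(1 / 2)] := by
  have h : Real.pi / 6 + 3 * (Real.pi / 3) = Real.pi / 6 + Real.pi := by ring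
  simp [normal, dir, h, Real.cos_add_pi, Real.sin_add_pi]

theorem normal_four : normal 4 = ![0, -1] := by
  have h : Real.pi / 6 + 4 * (Real.pi / 3) = Real.pi / 2 + Real.pi := by ring
  simp [normal, dir, h, Real.cos_add_pi, Real.sin_add_pi]

theorem normal_five : normal 5 = ![Real.sqrt 3 / 2, -(1 / 2)] := by
  have h : Real.pi / 6 + 5 * (Real.pi / 3) = -(Real.pi / 6) + 2 * Real.pi := by ring
  simp [normal, dir, h]

theorem normal_eq : normal = ![![Real.sqrt 3 / 2, 1 / 2], ![0, 1], ![-(Real.sqrt 3 / 2), 1 / 2],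
    ![-(Real.sqrt 3 / 2), -(1 / 2)], ![0, -1], ![Real.sqrt 3 / 2, -(1 / 2)]] := by
  funext k
  fin_cases k
  · exact normal_zero
  · exact normal_one
  · exact normal_two
  · exact normal_three
  · exact normal_four
  · exact normal_five

theorem sqrt_three_mul_self : Real.sqrt 3 * Real.sqrt 3 = 3 := Real.mul_self_sqrt (by norm_num)

/-! ### Symmetries -/

/-- A linear symmetry that permutes the sides commutes with the gluings and maps trajectories to
trajectories; the labels change by the induced permutation. -/
theorem mem_cuttingSequences_map {θ ψ : ℝ} (Q : Plane →ₗ[ℝ] Plane) (q : Equiv.Perm (Fin 6))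
    (r : Equiv.Perm Letter) (hQ : ∀ k z, normal (q k) ⬝ᵥ Q z = normal k ⬝ᵥ z)
    (hn : ∀ k, Q (normal k) = normal (q k)) (hd : Q (dir θ) = dir ψ)
    (hl : ∀ k, sideLabel (q k) = r (sideLabel k)) {w : Word} (hw : w ∈ cuttingSequences θ) :
    (fun n => r (w n)) ∈ cuttingSequences ψ := by
  obtain ⟨τ, rfl⟩ := hw
  have hQ' : ∀ k z, normal k ⬝ᵥ Q z = normal (q.symm k) ⬝ᵥ z := fun k z => by
    have := hQ (q.symm k) z
    rwa [q.apply_symm_apply] at this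
  have hglue : ∀ k z, glue (q k) (Q z) = Q (glue k z) := fun k z => by
    simp only [glue, map_sub, map_smul, hn]
  refine ⟨⟨fun n => Q (τ.pt n), fun n => q (τ.side n), τ.time, fun n => ⟨?_, fun j hj => ?_⟩,
    τ.time_pos, fun n => ?_, fun n t h0 h1 k => ?_⟩, funext fun n => hl _⟩
  · rw [hQ]
    exact (τ.pt_mem n).1
  · rw [hQ']
    refine (τ.pt_mem n).2 _ fun h => hj ?_
    rw [← h, q.apply_symm_apply]
  · rw [τ.step, hglue, map_add, map_smul, hd]
  · rw [hglue, ← hd, ← map_smul, ← map_add, hQ']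
    exact τ.inside n t h0 h1 _

theorem mem_cuttingSequences_rotate {θ : ℝ} {w : Word} (hw : w ∈ cuttingSequences θ) :
    (fun n => perm 2 (w n)) ∈ cuttingSequences (θ - Real.pi / 3) := by
  refine mem_cuttingSequences_map (nu 2).mulVecLin (Equiv.subRight 1) (perm 2) ?_ ?_ ?_ ?_ hw
  · intro k z
    rw [normal_eq]
    have h0 : Real.sqrt 3 * Real.sqrt 3 * z 0 = 3 * z 0 := by rw [sqrt_three_mul_self]
    have h1 : Real.sqrt 3 * Real.sqrt 3 * z 1 = 3 * z 1 := by rw [sqrt_three_mul_self]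
    fin_cases k <;> simp [nu, Matrix.mulVec, dotProduct, Fin.sum_univ_two] <;> linarith
  · intro k
    rw [normal_eq]
    fin_cases k <;> ext i <;> fin_cases i <;>
      simp [nu, Matrix.mulVec, dotProduct, Fin.sum_univ_two] <;>
      nlinarith [sqrt_three_mul_self]
  · ext i
    fin_cases i <;> simp [nu, dir, Matrix.mulVec, dotProduct, Fin.sum_univ_two, Real.cos_sub,
      Real.sin_sub] <;> ring
  · decide

theorem mem_cuttingSequences_reflect {θ : ℝ} {w : Word} (hw : w ∈ cuttingSequences θ) :
    (fun n => perm 1 (w n)) ∈ cuttingSequences (Real.pi / 3 - θ) := by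
  refine mem_cuttingSequences_map (nu 1).mulVecLin (Equiv.neg _) (perm 1) ?_ ?_ ?_ ?_ hw
  · intro k z
    rw [normal_eq]
    have h0 : Real.sqrt 3 * Real.sqrt 3 * z 0 = 3 * z 0 := by rw [sqrt_three_mul_self]
    have h1 : Real.sqrt 3 * Real.sqrt 3 * z 1 = 3 * z 1 := by rw [sqrt_three_mul_self]
    fin_cases k <;> simp [nu, Matrix.mulVec, dotProduct, Fin.sum_univ_two] <;> linarith
  · intro k
    rw [normal_eq]
    fin_cases k <;> ext i <;> fin_cases i <;>
      simp [nu, Matrix.mulVec, dotProduct, Fin.sum_univ_two] <;>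
      nlinarith [sqrt_three_mul_self]
  · ext i
    fin_cases i <;> simp [nu, dir, Matrix.mulVec, dotProduct, Fin.sum_univ_two, Real.cos_sub,
      Real.sin_sub] <;> ring
  · decide

theorem mem_cuttingSequences_congr {θ ψ : ℝ} (h : dir θ = dir ψ) {w : Word}
    (hw : w ∈ cuttingSequences θ) : w ∈ cuttingSequences ψ :=
  mem_cuttingSequences_map LinearMap.id 1 1 (fun _ _ => rfl) (fun _ => rfl) h (fun _ => rfl) hw

theorem rotate_mem_cuttingSequences_iff {θ : ℝ} {w : Word} :
    (fun n => perm 2 (w n)) ∈ cuttingSequences (θ - Real.pi / 3) ↔ w ∈ cuttingSequences θ := by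
  refine ⟨fun h => ?_, mem_cuttingSequences_rotate⟩
  -- The rotation has order six, so five more applications invert it, up to a full turn of the
  -- angle.
  have h5 := mem_cuttingSequences_rotate (mem_cuttingSequences_rotate
    (mem_cuttingSequences_rotate (mem_cuttingSequences_rotate (mem_cuttingSequences_rotate h))))
  have hp : ∀ L, perm 2 (perm 2 (perm 2 (perm 2 (perm 2 (perm 2 L))))) = L := by
    intro L; cases L <;> decide
  simp only [hp] at h5
  refine mem_cuttingSequences_congr ?_ h5
  have : θ - Real.pi / 3 - Real.pi / 3 - Real.pi / 3 - Real.pi / 3 - Real.pi / 3 - Real.pi / 3 =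
    θ - 2 * Real.pi := by ring
  rw [this, dir, dir, Real.cos_sub_two_pi, Real.sin_sub_two_pi]

theorem reflect_mem_cuttingSequences_iff {θ : ℝ} {w : Word} :
    (fun n => perm 1 (w n)) ∈ cuttingSequences (Real.pi / 3 - θ) ↔ w ∈ cuttingSequences θ := by
  refine ⟨fun h => ?_, mem_cuttingSequences_reflect⟩
  have h2 := mem_cuttingSequences_reflect h
  have hp : ∀ L, perm 1 (perm 1 L) = L := by
    intro L; cases L <;> decide
  simp only [hp, sub_sub_cancel] at h2
  exact h2

/-- Reduction of directions to the sector `0`. -/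
theorem exists_normalization {i : Fin 6} {θ : ℝ} (hθ : θ ∈ sector i) :
    ∃ ψ, 0 ≤ ψ ∧ ψ ≤ Real.pi / 6 ∧ dir ψ = (nu i).mulVec (dir θ) ∧
      ∀ w : Word, (fun n => perm i (w n)) ∈ cuttingSequences ψ ↔ w ∈ cuttingSequences θ := by
  have hr : ∀ (θ : ℝ) (w : Word), (fun n => perm 4 (w n)) ∈
      cuttingSequences (θ - Real.pi / 3 - Real.pi / 3) ↔ w ∈ cuttingSequences θ := by
    intro θ w
    have h1 := (rotate_mem_cuttingSequences_iff (θ := θ - Real.pi / 3)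
      (w := fun n => perm 2 (w n))).trans rotate_mem_cuttingSequences_iff
    have hp : ∀ L, perm 2 (perm 2 L) = perm 4 L := by
      intro L; cases L <;> decide
    simp only [hp] at h1
    exact h1
  have hdr : ∀ θ, dir (θ - Real.pi / 3) = (nu 2).mulVec (dir θ) := by
    intro θ
    ext i
    fin_cases i <;> simp [nu, dir, Matrix.mulVec, dotProduct, Fin.sum_univ_two, Real.cos_sub,
      Real.sin_sub] <;> ring
  have hds : ∀ θ, dir (Real.pi / 3 - θ) = (nu 1).mulVec (dir θ) := by
    intro θ
    ext i
    fin_cases i <;> simp [nu, dir, Matrix.mulVec, dotProduct, Fin.sum_univ_two, Real.cos_sub,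
      Real.sin_sub] <;> ring
  have m22 : nu 2 * nu 2 = nu 4 := by
    ext i j
    fin_cases i <;> fin_cases j <;> simp [nu, Matrix.mul_apply, Fin.sum_univ_two] <;>
      nlinarith [sqrt_three_mul_self]
  have m12 : nu 1 * nu 2 = nu 3 := by
    ext i j
    fin_cases i <;> fin_cases j <;> simp [nu, Matrix.mul_apply, Fin.sum_univ_two] <;>
      nlinarith [sqrt_three_mul_self]
  have m14 : nu 1 * nu 4 = nu 5 := by
    ext i j
    fin_cases i <;> fin_cases j <;> simp [nu, Matrix.mul_apply, Fin.sum_univ_two] <;>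
      nlinarith [sqrt_three_mul_self]
  obtain ⟨hl, hu⟩ := hθ
  fin_cases i <;> norm_num at hl hu
  · refine ⟨θ, by linarith, by linarith, ?_, fun w => Iff.rfl⟩
    ext i
    fin_cases i <;> simp [nu, Matrix.mulVec, dotProduct, Fin.sum_univ_two]
  · exact ⟨Real.pi / 3 - θ, by linarith, by linarith, hds θ,
      fun w => reflect_mem_cuttingSequences_iff⟩
  · exact ⟨θ - Real.pi / 3, by linarith, by linarith, hdr θ,
      fun w => rotate_mem_cuttingSequences_iff⟩
  · refine ⟨Real.pi / 3 - (θ - Real.pi / 3), by linarith, by linarith, ?_, fun w => ?_⟩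
    · rw [hds, hdr, Matrix.mulVec_mulVec, m12]; rfl
    · have h1 := (reflect_mem_cuttingSequences_iff (θ := θ - Real.pi / 3)
        (w := fun n => perm 2 (w n))).trans rotate_mem_cuttingSequences_iff
      have hp : ∀ L, perm 1 (perm 2 L) = perm 3 L := by
        intro L; cases L <;> decide
      simp only [hp] at h1
      exact h1
  · refine ⟨θ - Real.pi / 3 - Real.pi / 3, by linarith, by linarith, ?_, fun w => hr θ w⟩
    rw [hdr, hdr, Matrix.mulVec_mulVec, m22]; rfl
  · refine ⟨Real.pi / 3 - (θ - Real.pi / 3 - Real.pi / 3), by linarith, by linarith, ?_,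
      fun w => ?_⟩
    · rw [hds, hdr, hdr, Matrix.mulVec_mulVec (dir θ), m22, Matrix.mulVec_mulVec, m14]; rfl
    · have h1 := (reflect_mem_cuttingSequences_iff (θ := θ - Real.pi / 3 - Real.pi / 3)
        (w := fun n => perm 4 (w n))).trans (hr θ w)
      have hp : ∀ L, perm 1 (perm 4 L) = perm 5 L := by
        intro L; cases L <;> decide
      simp only [hp] at h1
      exact h1

theorem isReading_iff_zero {i : Fin 6} {b : ℤ → Arrow} {w : Word} :
    IsReading i b w ↔ IsReading 0 b fun n => perm i (w n) := by
  rw [isReading_iff, isReading_iff]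
  refine and_congr_right fun _ => forall_congr' fun n => ?_
  rw [vertex_eq_perm, Equiv.Perm.eq_inv_iff_eq]

/-! ### Trajectories and orbits of the interval exchange -/

/-- Twice the signed area spanned by two vectors. -/
def cross (d z : Plane) : ℝ := d 0 * z 1 - d 1 * z 0

theorem cross_add (d z z' : Plane) : cross d (z + z') = cross d z + cross d z' := by
  simp [cross]; ring

theorem cross_sub (d z z' : Plane) : cross d (z - z') = cross d z - cross d z' := by
  simp [cross]; ring

theorem cross_smul (d z : Plane) (t : ℝ) : cross d (t • z) = t * cross d z := by
  simp [cross]; ring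

theorem cross_self (d : Plane) : cross d d = 0 := by
  simp [cross]; ring

/-- The point of the line carrying the `k`-th side at the distance `r` from its middle. -/
noncomputable def sidePoint (k : Fin 6) (r : ℝ) : Plane :=
  (Real.sqrt 3 / 2) • normal k + r • ![-normal k 1, normal k 0]

theorem normal_norm (k : Fin 6) : normal k 0 * normal k 0 + normal k 1 * normal k 1 = 1 := by
  have := Real.cos_sq_add_sin_sq (Real.pi / 6 + (k : ℕ) * (Real.pi / 3))
  simp only [normal, dir, Matrix.cons_val_zero, Matrix.cons_val_one]
  linarith

theorem cross_sidePoint (d : Plane) (k : Fin 6) (r : ℝ) :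
    cross d (sidePoint k r) = Real.sqrt 3 / 2 * cross d (normal k) + r * (normal k ⬝ᵥ d) := by
  simp [cross, sidePoint, dotProduct, Fin.sum_univ_two]; ring

theorem normal_add_three (k : Fin 6) : normal (k + 3) = -normal k := by
  rw [normal_eq]
  fin_cases k <;> ext i <;> fin_cases i <;> simp

theorem sidePoint_apply_zero (k : Fin 6) (r : ℝ) :
    sidePoint k r 0 = Real.sqrt 3 / 2 * normal k 0 - r * normal k 1 := by
  simp [sidePoint]; ring

theorem sidePoint_apply_one (k : Fin 6) (r : ℝ) :
    sidePoint k r 1 = Real.sqrt 3 / 2 * normal k 1 + r * normal k 0 := by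
  simp [sidePoint]

theorem glue_sidePoint (k : Fin 6) (r : ℝ) : glue k (sidePoint k r) = sidePoint (k + 3) (-r) := by
  ext i
  fin_cases i <;>
    simp [glue, sidePoint_apply_zero, sidePoint_apply_one, normal_add_three] <;> ring

theorem normal_dotProduct_sidePoint (k : Fin 6) (r : ℝ) :
    normal k ⬝ᵥ sidePoint k r = Real.sqrt 3 / 2 := by
  have := normal_norm k
  simp [sidePoint, dotProduct, Fin.sum_univ_two]
  linear_combination Real.sqrt 3 / 2 * this

theorem sidePoint_mem_openSide (k : Fin 6) {r : ℝ} (hr : |r| < 1 / 2) :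
    sidePoint k r ∈ openSide k := by
  refine ⟨normal_dotProduct_sidePoint k r, fun j hj => ?_⟩
  obtain ⟨h1, h2⟩ := abs_lt.1 hr
  have h3 : 0 < Real.sqrt 3 := by positivity
  have h4 := mul_lt_mul_of_pos_left h1 h3
  have h5 := mul_lt_mul_of_pos_left h2 h3
  have h6 : Real.sqrt 3 * Real.sqrt 3 * Real.sqrt 3 = 3 * Real.sqrt 3 := by
    rw [sqrt_three_mul_self]
  have h7 : Real.sqrt 3 * Real.sqrt 3 * r = 3 * r := by rw [sqrt_three_mul_self]
  simp only [sidePoint, normal_eq]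
  fin_cases k <;> fin_cases j <;> first
    | exact absurd rfl hj
    | (simp [dotProduct, Fin.sum_univ_two] <;> linarith)

theorem eq_sidePoint {k : Fin 6} {z : Plane} (hz : z ∈ openSide k) :
    |cross (normal k) z| < 1 / 2 ∧ z = sidePoint k (cross (normal k) z) := by
  obtain ⟨h0, h⟩ := hz
  have hz' : z = sidePoint k (cross (normal k) z) := by
    have h1 := normal_norm k
    simp [dotProduct, Fin.sum_univ_two] at h0
    ext i
    fin_cases i <;> simp [sidePoint, cross, ← h0]
    · linear_combination (-z 0) * h1
    · linear_combination (-z 1) * h1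
  refine ⟨?_, hz'⟩
  -- The two neighbouring sides alone bound the position on the side.
  have hne : ∀ k : Fin 6, k + 1 ≠ k ∧ k - 1 ≠ k := by decide
  have h1 := h (k + 1) (hne k).1
  have h2 := h (k - 1) (hne k).2
  rw [hz'] at h1 h2
  generalize cross (normal k) z = r at *
  have h3 : 0 < Real.sqrt 3 := by positivity
  have h6 : Real.sqrt 3 * Real.sqrt 3 * Real.sqrt 3 = 3 * Real.sqrt 3 := by
    rw [sqrt_three_mul_self]
  have h7 : Real.sqrt 3 * Real.sqrt 3 * r = 3 * r := by rw [sqrt_three_mul_self]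
  have key : Real.sqrt 3 * r < Real.sqrt 3 * (1 / 2) ∧
      Real.sqrt 3 * (-r) < Real.sqrt 3 * (1 / 2) := by
    simp only [sidePoint, normal_eq] at h1 h2
    fin_cases k <;> simp [dotProduct, Fin.sum_univ_two] at h1 h2 <;> constructor <;> linarith
  have h8 := lt_of_mul_lt_mul_left key.1 h3.le
  have h9 := lt_of_mul_lt_mul_left key.2 h3.le
  rw [abs_lt]
  constructor <;> linarith

/-- The sides hit by the trajectories with direction in the sector `0`. -/
def sideAt : Fin 3 → Fin 6 := ![1, 5, 0]

theorem sideLabel_sideAt (v : Fin 3) : sideLabel (sideAt v) = vertex 0 v := by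
  revert v; decide

theorem sideAt_ne (v v' : Fin 3) : sideAt v ≠ sideAt v' + 3 := by
  revert v v'; decide

/-- The translation of the transverse coordinate on the intervals of the exchange. -/
def shift (α κ : ℝ) : Fin 3 → ℝ := ![-3 * α - 2 * κ, 3 * α + κ, -κ]

theorem disp_eq_shift (α κ : ℝ) (a : Arrow) :
    disp α κ a = shift α κ a.src + shift α κ a.tgt := by
  cases a <;> simp [disp, shift, Arrow.src, Arrow.tgt] <;> ring

/-- The transitions missing from the common diagram are excluded because their displacement is too
large for the two intervals. -/
theorem exists_arrow_of_shift {α κ t : ℝ} (hα : 0 ≤ α) (hκ : 0 ≤ κ) {v v' : Fin 3}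
    (h : |t| < width α κ v) (h' : |t + (shift α κ v + shift α κ v')| < width α κ v') :
    ∃ a : Arrow, a.src = v ∧ a.tgt = v' := by
  have harrow : ∀ v v' : Fin 3, (∃ a : Arrow, a.src = v ∧ a.tgt = v') ∨
      (v = 0 ∧ v' ≠ 1) ∨ (v = 1 ∧ v' = 1) ∨ (v = 2 ∧ v' = 0) := by decide
  rw [abs_lt] at h h'
  obtain ⟨h1, h2⟩ := h
  obtain ⟨h3, h4⟩ := h'
  rcases harrow v v' with h | ⟨rfl, hv'⟩ | ⟨rfl, rfl⟩ | ⟨rfl, rfl⟩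
  · exact h
  · exfalso
    fin_cases v' <;> simp [width, shift] at hv' h1 h2 h3 h4 <;> linarith
  · exfalso
    simp [width, shift] at h1 h2 h3 h4
    linarith
  · exfalso
    simp [width, shift] at h1 h2 h3 h4
    linarith

section Direction

variable {ψ : ℝ}

theorem width_eq (v : Fin 3) :
    width (2 * Real.sin ψ) (Real.sqrt 3 * Real.cos ψ - 3 * Real.sin ψ) v =
      2 * (normal (sideAt v) ⬝ᵥ dir ψ) := by
  rw [normal_eq]
  fin_cases v <;> simp [width, sideAt, dir, dotProduct, Fin.sum_univ_two] <;> ring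

/-- The flight between the middles of two sides, after gluing, is `√3 / 2` times the sum of their
normals. Each side contributes its own half to the displacement of the coordinate. -/
theorem shift_eq (v : Fin 3) :
    shift (2 * Real.sin ψ) (Real.sqrt 3 * Real.cos ψ - 3 * Real.sin ψ) v =
      -(2 * Real.sqrt 3) * cross (dir ψ) (normal (sideAt v)) := by
  have h := sqrt_three_mul_self
  rw [normal_eq]
  fin_cases v <;> simp [shift, sideAt, dir, cross]
  · ring
  · linear_combination (-Real.sin ψ) * h
  · linear_combination (-Real.sin ψ) * h

theorem sqrt_three_mul_sin_le (h0 : 0 ≤ ψ) (h1 : ψ ≤ Real.pi / 6) :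
    3 * Real.sin ψ ≤ Real.sqrt 3 * Real.cos ψ := by
  have hpi := Real.pi_pos
  have hs : Real.sin ψ ≤ 1 / 2 := by
    rw [← Real.sin_pi_div_six]
    exact Real.sin_le_sin_of_le_of_le_pi_div_two (by linarith) (by linarith) h1
  have hc : Real.sqrt 3 / 2 ≤ Real.cos ψ := by
    rw [← Real.cos_pi_div_six]
    exact Real.cos_le_cos_of_nonneg_of_le_pi h0 (by linarith) h1
  have := mul_le_mul_of_nonneg_left hc (Real.sqrt_nonneg 3)
  linarith [sqrt_three_mul_self]

theorem exists_sideAt (h0 : 0 ≤ ψ) (h1 : ψ ≤ Real.pi / 6) {k : Fin 6}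
    (hk : 0 < normal k ⬝ᵥ dir ψ) : ∃ v, sideAt v = k := by
  have hpi := Real.pi_pos
  have hs : 0 ≤ Real.sin ψ := Real.sin_nonneg_of_nonneg_of_le_pi h0 (by linarith)
  have hc := sqrt_three_mul_sin_le h0 h1
  have hside : ∀ k : Fin 6, (∃ v, sideAt v = k) ∨ k = 2 ∨ k = 3 ∨ k = 4 := by decide
  rw [normal_eq] at hk
  rcases hside k with h | rfl | rfl | rfl
  · exact h
  all_goals
    simp [dir, dotProduct, Fin.sum_univ_two] at hk
    linarith

/-- Halfway along the flight the point is strictly inside the hexagon, and at the end it is on the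
side. The normal component therefore increases along the direction. -/
theorem Trajectory.dir_pos {θ : ℝ} (τ : Trajectory θ) (n : ℤ) :
    0 < normal (τ.side n) ⬝ᵥ dir θ := by
  have h1 := τ.step (n - 1)
  have hT := τ.time_pos (n - 1)
  have h2 := τ.inside (n - 1) (τ.time (n - 1) / 2) (by linarith) (by linarith) (τ.side n)
  have h3 := (τ.pt_mem n).1
  rw [sub_add_cancel] at h1
  rw [h1, dotProduct_add, dotProduct_smul, smul_eq_mul] at h3
  rw [dotProduct_add, dotProduct_smul, smul_eq_mul] at h2
  nlinarith

theorem Trajectory.exists_isCoding (h0 : 0 ≤ ψ) (h1 : ψ ≤ Real.pi / 6) (τ : Trajectory ψ) :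
    ∃ b, IsReading 0 b τ.cut ∧
      IsCoding (2 * Real.sin ψ) (Real.sqrt 3 * Real.cos ψ - 3 * Real.sin ψ) b := by
  have hpi := Real.pi_pos
  have hα : 0 ≤ 2 * Real.sin ψ :=
    mul_nonneg two_pos.le (Real.sin_nonneg_of_nonneg_of_le_pi h0 (by linarith))
  have hκ := sub_nonneg.2 (sqrt_three_mul_sin_le h0 h1)
  choose v hv using fun n => exists_sideAt h0 h1 (τ.dir_pos n)
  set α := 2 * Real.sin ψ with hα'
  set κ := Real.sqrt 3 * Real.cos ψ - 3 * Real.sin ψ with hκ'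
  let r : ℤ → ℝ := fun n => cross (normal (τ.side n)) (τ.pt n)
  -- The factor `4` turns the bound `|r n| < 1 / 2` into `|M n| < 2 * (normal · dir)`, which is the
  -- value of `width`.
  let M : ℤ → ℝ := fun n => 4 * (r n * (normal (τ.side n) ⬝ᵥ dir ψ))
  have hr : ∀ n, |r n| < 1 / 2 := fun n => (eq_sidePoint (τ.pt_mem n)).1
  have hpt : ∀ n, τ.pt n = sidePoint (τ.side n) (r n) := fun n => (eq_sidePoint (τ.pt_mem n)).2
  have hM : ∀ n, |M n| < width α κ (v n) := fun n => by
    have hpos := τ.dir_pos n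
    rw [width_eq, hv]
    simp only [M]
    rw [abs_mul, abs_mul, abs_of_pos hpos, abs_of_pos (by norm_num : (0 : ℝ) < 4)]
    have := mul_lt_mul_of_pos_right (hr n) hpos
    linarith
  have hstep : ∀ n, M (n + 1) = M n + (shift α κ (v n) + shift α κ (v (n + 1))) := fun n => by
    have h2 := congrArg (cross (dir ψ)) (τ.step n)
    rw [hpt, cross_add, cross_smul, cross_self, glue, cross_sub, cross_smul, hpt,
      cross_sidePoint, cross_sidePoint] at h2
    simp only [shift_eq, hv, M, α, κ]
    linear_combination 4 * h2
  choose b hb hb' using fun n => exists_arrow_of_shift hα hκ (hM n) (hstep n ▸ hM (n + 1))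
  refine ⟨b, isReading_iff.2 ⟨fun n => by rw [hb', hb], fun n => ?_⟩, M, fun n => by rw [hb', hb],
    fun n => ⟨by rw [hb]; exact hM n, ?_⟩⟩
  · rw [hb, ← sideLabel_sideAt, hv]
    rfl
  · rw [hstep, disp_eq_shift, hb, hb']

theorem eq_smul_dir {z : Plane} (h : cross (dir ψ) z = 0) : z = (dir ψ ⬝ᵥ z) • dir ψ := by
  have h1 := Real.cos_sq_add_sin_sq ψ
  simp [cross, dir] at h
  ext i
  fin_cases i <;> simp [dir, dotProduct, Fin.sum_univ_two]
  · linear_combination (-z 0) * h1 - Real.sin ψ * h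
  · linear_combination (-z 1) * h1 + Real.cos ψ * h

/-- The coordinate determines the point on each side, and the displacement rule says that
consecutive points differ by a multiple of the direction. This multiple is positive since the flight
starts strictly inside the half-plane of the next side. -/
theorem exists_trajectory {α κ : ℝ} (hα : α = 2 * Real.sin ψ)
    (hκ : κ = Real.sqrt 3 * Real.cos ψ - 3 * Real.sin ψ) {b : ℤ → Arrow} (hb : IsCoding α κ b) :
    ∃ τ : Trajectory ψ, ∀ n, τ.side n = sideAt (b n).src := by
  obtain ⟨M, hb, hM⟩ := hb
  let k : ℤ → Fin 6 := fun n => sideAt (b n).src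
  let e : ℤ → ℝ := fun n => normal (k n) ⬝ᵥ dir ψ
  let r : ℤ → ℝ := fun n => M n / (4 * e n)
  have hw : ∀ n, width α κ (b n).src = 2 * e n := fun n => by
    subst hα hκ
    exact width_eq _
  have he : ∀ n, 0 < e n := fun n => by
    have := (abs_nonneg _).trans_lt (hM n).1
    rw [hw] at this
    linarith
  have hr : ∀ n, |r n| < 1 / 2 := fun n => by
    have h1 := (hM n).1
    have h2 := he n
    rw [hw] at h1
    simp only [r]
    rw [abs_div, abs_of_pos (by linarith : 0 < 4 * e n), div_lt_iff₀ (by linarith)]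
    linarith
  have hre : ∀ n, r n * e n = M n / 4 := fun n => by
    have := (he n).ne'
    simp only [r]
    field_simp
  let p : ℤ → Plane := fun n => sidePoint (k n) (r n)
  have hp : ∀ n, p n ∈ openSide (k n) := fun n => sidePoint_mem_openSide _ (hr n)
  have hg : ∀ n, glue (k n) (p n) ∈ openSide (k n + 3) := fun n => by
    simp only [p]
    rw [glue_sidePoint]
    exact sidePoint_mem_openSide _ (by rw [abs_neg]; exact hr n)
  let T : ℤ → ℝ := fun n => dir ψ ⬝ᵥ (p (n + 1) - glue (k n) (p n))
  have hstep : ∀ n, p (n + 1) = glue (k n) (p n) + T n • dir ψ := fun n => by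
    rw [← eq_smul_dir (z := p (n + 1) - glue (k n) (p n)), add_sub_cancel]
    have h1 := (hM n).2
    have h2 := hre n
    have h3 := hre (n + 1)
    rw [disp_eq_shift, hb n] at h1
    subst hα hκ
    rw [shift_eq, shift_eq] at h1
    rw [glue, cross_sub, cross_sub, cross_smul, cross_sidePoint, cross_sidePoint]
    change _ + r (n + 1) * e (n + 1) - (_ + r n * e n - _) = 0
    rw [h2, h3, h1]
    simp only [k]
    ring
  have hle : ∀ (j i : Fin 6) {z : Plane}, z ∈ openSide i → normal j ⬝ᵥ z ≤ Real.sqrt 3 / 2 :=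
    fun j i z hz => by
      by_cases hj : j = i
      · rw [hj]; exact hz.1.le
      · exact (hz.2 j hj).le
  have hTpos : ∀ n, 0 < T n := fun n => by
    have h1 := (hp (n + 1)).1
    have h2 := (hg n).2 (k (n + 1)) (sideAt_ne _ _)
    rw [hstep, dotProduct_add, dotProduct_smul, smul_eq_mul] at h1
    have h3 : 0 < T n * e (n + 1) := by
      change _ + T n * e (n + 1) = _ at h1
      linarith
    exact pos_of_mul_pos_left h3 (he _).le
  refine ⟨⟨p, k, T, hp, hTpos, hstep, fun n t h0 h1 j => ?_⟩, fun n => rfl⟩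
  have h2 := hle j _ (hg n)
  have h3 := hle j _ (hp (n + 1))
  -- By convexity, a strict inequality at one end of the flight suffices. The two ends lie on
  -- different open sides, so no side contains both.
  have h4 : normal j ⬝ᵥ glue (k n) (p n) < Real.sqrt 3 / 2 ∨
      normal j ⬝ᵥ p (n + 1) < Real.sqrt 3 / 2 := by
    by_cases hj : j = k n + 3
    · exact Or.inr ((hp (n + 1)).2 j (by rw [hj]; exact (sideAt_ne _ _).symm))
    · exact Or.inl ((hg n).2 j hj)
  rw [hstep, dotProduct_add, dotProduct_smul, smul_eq_mul] at h3 h4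
  rw [dotProduct_add, dotProduct_smul, smul_eq_mul]
  have h5 := hTpos n
  generalize normal j ⬝ᵥ glue (k n) (p n) = f at *
  generalize normal j ⬝ᵥ dir ψ = g at *
  refine lt_of_mul_lt_mul_left (a := T n) ?_ h5.le
  have h6 : T n * (f + t * g) = (T n - t) * f + t * (f + T n * g) := by ring
  have h7 := mul_le_mul_of_nonneg_left h2 (sub_pos.2 h1).le
  have h8 := mul_le_mul_of_nonneg_left h3 h0.le
  rcases h4 with h4 | h4
  · have := mul_lt_mul_of_pos_left h4 (sub_pos.2 h1)
    linarith
  · have := mul_lt_mul_of_pos_left h4 h0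
    linarith

theorem mem_cuttingSequences_iff (h0 : 0 ≤ ψ) (h1 : ψ ≤ Real.pi / 6) {w : Word} :
    w ∈ cuttingSequences ψ ↔ ∃ b, IsReading 0 b w ∧
      IsCoding (2 * Real.sin ψ) (Real.sqrt 3 * Real.cos ψ - 3 * Real.sin ψ) b := by
  constructor
  · rintro ⟨τ, rfl⟩
    exact τ.exists_isCoding h0 h1
  · rintro ⟨b, hb, hcod⟩
    obtain ⟨τ, hτ⟩ := exists_trajectory rfl rfl hcod
    refine ⟨τ, funext fun n => ?_⟩
    rw [(isReading_iff.1 hb).2, ← sideLabel_sideAt, ← hτ]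
    rfl

end Direction

/-! ### Parameters of a Farey expansion -/

/-- The parameters of a direction vector in the sector `0`. -/
noncomputable def vecParams (z : Plane) : ℝ × ℝ := (2 * z 1, Real.sqrt 3 * z 0 - 3 * z 1)

theorem vecParams_smul (t : ℝ) (z : Plane) :
    vecParams (t • z) = (t * (vecParams z).1, t * (vecParams z).2) := by
  ext <;> simp [vecParams] <;> ring

/-- In the coordinates `vecParams`, the inverse of the matrix of `ν_j γ` is the nonnegative integer
matrix of `liftParams j`. -/
theorem vecParams_eq_lift {j : Fin 6} (hj : j ≠ 0) (z : Plane) :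
    vecParams z = liftParams j (vecParams ((nu j).mulVec (gam.mulVec z))) := by
  have h3 := sqrt_three_mul_self
  have h0 : Real.sqrt 3 * Real.sqrt 3 * z 0 = 3 * z 0 := by rw [h3]
  have h1 : Real.sqrt 3 * Real.sqrt 3 * z 1 = 3 * z 1 := by rw [h3]
  have h2 : Real.sqrt 3 * Real.sqrt 3 * Real.sqrt 3 * z 1 = 3 * Real.sqrt 3 * z 1 := by rw [h3]
  fin_cases j
  · exact absurd rfl hj
  all_goals
    ext <;> simp [vecParams, liftParams, nu, gam, Matrix.mulVec, dotProduct, Fin.sum_univ_two] <;>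
      linarith

/-- The successive images of a direction vector. -/
noncomputable def vecOrbit (s : ℕ → Fin 6) (θ : ℝ) : ℕ → Plane
  | 0 => (nu (s 0)).mulVec (dir θ)
  | k + 1 => (nu (s (k + 1))).mulVec (gam.mulVec (vecOrbit s θ k))

theorem exists_smul_dir_fareyBranch (i : Fin 6) (θ : ℝ) :
    ∃ t : ℝ, 0 ≤ t ∧ (gam * nu i).mulVec (dir θ) = t • dir (fareyBranch i θ) := by
  let c : ℂ := ⟨((gam * nu i).mulVec (dir θ)) 0, ((gam * nu i).mulVec (dir θ)) 1⟩
  refine ⟨‖c‖, norm_nonneg c, ?_⟩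
  ext j
  fin_cases j
  · exact (Complex.norm_mul_cos_arg c).symm
  · exact (Complex.norm_mul_sin_arg c).symm

/-- The vectors are not normalized, so that the parameters obey an exact linear recursion. They
differ from the unit directions only by nonnegative factors, which keeps the sign information of the
sectors. -/
theorem exists_vecOrbit_eq (s : ℕ → Fin 6) (θ : ℝ) (k : ℕ) :
    ∃ t : ℝ, 0 ≤ t ∧ vecOrbit s θ k = t • (nu (s k)).mulVec (dir (fareyOrbit s θ k)) := by
  induction k with
  | zero => exact ⟨1, zero_le_one, by simp [vecOrbit, fareyOrbit]⟩
  | succ k ih =>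
    obtain ⟨t, ht, h⟩ := ih
    obtain ⟨r, hr, h'⟩ := exists_smul_dir_fareyBranch (s k) (fareyOrbit s θ k)
    refine ⟨t * r, mul_nonneg ht hr, ?_⟩
    rw [vecOrbit, h, fareyOrbit, Matrix.mulVec_smul, Matrix.mulVec_mulVec, h', smul_smul,
      Matrix.mulVec_smul]

theorem isParams_vecOrbit {s : ℕ → Fin 6} {θ : ℝ} (hs : IsFareyExpansion s θ) :
    IsParams s fun k => vecParams (vecOrbit s θ k) := by
  have hpi := Real.pi_pos
  have hnonneg : ∀ k, 0 ≤ (vecParams (vecOrbit s θ k)).1 ∧ 0 ≤ (vecParams (vecOrbit s θ k)).2 := by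
    intro k
    obtain ⟨t, ht, h⟩ := exists_vecOrbit_eq s θ k
    obtain ⟨ψ, h0, h1, hψ, -⟩ := exists_normalization (hs.2 k)
    rw [h, vecParams_smul, ← hψ]
    exact ⟨mul_nonneg ht (mul_nonneg two_pos.le
      (Real.sin_nonneg_of_nonneg_of_le_pi h0 (by linarith))),
      mul_nonneg ht (sub_nonneg.2 (sqrt_three_mul_sin_le h0 h1))⟩
  refine ⟨fun k => hs.1 _ (by omega), fun k => (hnonneg k).1, fun k => (hnonneg k).2,
    fun k => vecParams_eq_lift (hs.1 _ (by omega)) _, fun h => ?_⟩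
  obtain ⟨ψ, h0, h1, hψ, -⟩ := exists_normalization (hs.2 0)
  simp only [vecOrbit] at h
  rw [show θ = fareyOrbit s θ 0 from rfl, ← hψ] at h
  have h2 : 2 * Real.sin ψ = 0 := congrArg Prod.fst h
  have h3 : Real.sqrt 3 * Real.cos ψ - 3 * Real.sin ψ = 0 := congrArg Prod.snd h
  have h4 : Real.cos ψ = 0 := by
    have : Real.sqrt 3 * Real.cos ψ = 0 := by linarith
    simpa using this
  have := Real.cos_sq_add_sin_sq ψ
  rw [h4, show Real.sin ψ = 0 by linarith] at this
  norm_num at this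

theorem mem_cuttingSequences_iff_coding {s : ℕ → Fin 6} {θ : ℝ} (hs : IsFareyExpansion s θ)
    (w : Word) : w ∈ cuttingSequences θ ↔ ∃ b, IsReading (s 0) b w ∧
      IsCoding (vecParams (vecOrbit s θ 0)).1 (vecParams (vecOrbit s θ 0)).2 b := by
  obtain ⟨ψ, h0, h1, hψ, h⟩ := exists_normalization (hs.2 0)
  rw [show θ = fareyOrbit s θ 0 from rfl, ← h, mem_cuttingSequences_iff h0 h1]
  simp only [vecOrbit]
  rw [← hψ]
  exact exists_congr fun b => and_congr_left fun _ => isReading_iff_zero.symm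

theorem inSubstIntersection_iff {s : ℕ → Fin 6} {b : ℤ → Arrow} {w : Word}
    (hb : IsReading (s 0) b w) :
    InSubstIntersection s w ↔ ∀ k, ∃ a, IsSubstComp s k a b := by
  refine forall_congr' fun k => ⟨?_, fun ⟨a, ha⟩ => ⟨a, b, ha, hb⟩⟩
  rintro ⟨a, b', ha, hb'⟩
  exact ⟨a, hb.eq hb' ▸ ha⟩

theorem IsReading.periodic_iff {i : Fin 6} {b : ℤ → Arrow} {w : Word} (hb : IsReading i b w)
    (P : ℤ) : (∀ n, w (n + P) = w n) ↔ ∀ n, b (n + P) = b n := by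
  constructor
  · intro h n
    refine Joins.eq (hb (n + P)) ?_
    rw [h, add_right_comm, h]
    exact hb n
  · intro h n
    rw [(isReading_iff.1 hb).2, (isReading_iff.1 hb).2, h]

end HexCut

theorem mainTheorem6 (θ : ℝ) (s : ℕ → Fin 6) (hs : HexCut.IsFareyExpansion s θ)
    (w : HexCut.Word) :
    (w ∈ HexCut.cuttingSequences θ → HexCut.InGenIntersection s w) ∧
    (¬ HexCut.Terminating s →
      (w ∈ closure (HexCut.cuttingSequences θ) ↔ HexCut.InGenIntersection s w)) ∧
    (HexCut.Terminating s →
      (w ∈ HexCut.cuttingSequences θ ↔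
        HexCut.InGenIntersection s w ∧ ∃ p : ℤ, 0 < p ∧ ∀ n, w (n + p) = w n)) ∧
    (HexCut.InGenIntersection s w ↔ HexCut.InSubstIntersection s w) := by
  have hx := HexCut.isParams_vecOrbit hs
  have hC := HexCut.mem_cuttingSequences_iff_coding hs
  rw [HexCut.inGenIntersection_iff]
  refine ⟨fun hw => ?_, fun hT => hx.mem_closure_iff hT hC w, fun hT => ?_, Iff.rfl⟩
  · obtain ⟨b, hb, hcod⟩ := (hC w).1 hw
    refine (HexCut.inSubstIntersection_iff hb).2 fun k => ?_
    obtain ⟨a, -, ha⟩ := (hx.isCoding_iff k).1 hcod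
    exact ⟨a, ha⟩
  · rw [hC]
    constructor
    · rintro ⟨b, hb, hcod⟩
      obtain ⟨-, hG, P, hP, hP'⟩ := (hx.isCoding_iff_periodic hT).1 hcod
      exact ⟨(HexCut.inSubstIntersection_iff hb).2 hG, P, hP, (hb.periodic_iff P).2 hP'⟩
    · rintro ⟨hG, P, hP, hP'⟩
      obtain ⟨-, b, -, hb⟩ := hG 0
      exact ⟨b, hb, (hx.isCoding_iff_periodic hT).2 ⟨(HexCut.isReading_iff.1 hb).1,
        (HexCut.inSubstIntersection_iff hb).1 hG, P, hP, (hb.periodic_iff P).1 hP'⟩⟩
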